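/- Let $\mathbf{k}$ be a field of characteristic $0$. A pre-Leibniz algebra is a $\mathbf{k}$-vector space $\mathfrak{a}$ with two bilinear operations $\triangleleft,\triangleright:\mathfrak{a}\otimes\mathfrak{a}\to\mathfrak{a}$ such that, for all $x,y,z\in\mathfrak{a}$, $$x\triangleleft(y\triangleleft z+y\triangleright z)=(x\triangleleft y)\triangleleft z+y\triangleright(x\triangleleft z),\qquad x\triangleright(y\triangleleft z)=(x\triangleright y)\triangleleft z+y\triangleleft(x\triangleleft z+x\triangleright z),$$ $$x\triangleright(y\triangleright z)=(x\triangleleft y+x\triangleright y)\triangleright z+y\triangleright(x\triangleright z).$$ Cochains. For $n\ge 1$ let $C_n=\{[1],\dots,[n]\}$ and $C^n_{\mathsf{pL}}(\mathfrak{a},\mathfrak{a})=\mathrm{Hom}(\mathbf{k}[C_n]\otimes\mathfrak{a}^{\otimes n},\mathfrak{a})$. Let $m,n\ge1$ and $1\le i\le m$. For a shuffle $\sigma\in Sh(i-1,n-1)$ (a permutation of $\{1,\dots,i+n-2\}$ increasing on the first $i-1$ and on the last $n-1$ places) put the elements of $C_{m+n-1}$ into $m$ boxes: $[\sigma(1)],\dots,[\sigma(i-1)]$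 alone in the boxes $1,\dots,i-1$; then $[\sigma(i)],\dots,[\sigma(i+n-2)],[i+n-1]$, in this order, in box $i$; then $[i+n],\dots,[m+n-1]$ alone in the boxes $i+1,\dots,m$. Let $R^\sigma_{m;i,n}[r]=[l]\in C_m$ if $[r]$ lies in box $l$. Let $S^\sigma_{m;i,n}[r]\in\mathbf{k}[C_n]$ be $[j]$ if $[r]$ is the $j$-th element of box $i$, and $[1]+\cdots+[n]$ if $[r]$ is not in box $i$. For $f\in C^m_{\mathsf{pL}}(\mathfrak{a},\mathfrak{a})$ and $g\in C^n_{\mathsf{pL}}(\mathfrak{a},\mathfrak{a})$ let $$(f\diamond_i g)([r];x_1,\dots,x_{m+n-1})=\sum_{\sigma\in Sh(i-1,n-1)}(-1)^\sigma f\big(R^\sigma_{m;i,n}[r];x_{\sigma(1)},\dots,x_{\sigma(i-1)},g(S^\sigma_{m;i,n}[r];x_{\sigma(i)},\dots,x_{\sigma(i+n-2)},x_{i+n-1}),x_{i+n},\dots,x_{m+n-1}\big),$$ $$\llbracket f,g\rrbracket_{\mathsf{pL}}=\sum_{i=1}^m(-1)^{(i-1)(n-1)}f\diamond_i g-(-1)^{(m-1)(n-1)}\sum_{i=1}^n(-1)^{(i-1)(m-1)}g\diamond_i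 f\ \in C^{m+n-1}_{\mathsf{pL}}(\mathfrak{a},\mathfrak{a}).$$ Cohomology. Define $\pi\in C^2_{\mathsf{pL}}(\mathfrak{a},\mathfrak{a})$ by $\pi([1];x,y)=x\triangleleft y$, $\pi([2];x,y)=x\triangleright y$, and put $d_\pi=\llbracket\pi,-\rrbracket_{\mathsf{pL}}$. The cohomology of $\mathfrak{a}$ with coefficients in the adjoint representation is $H^n_{\mathsf{pL}}(\mathfrak{a},\mathfrak{a})=Z^n_{\mathsf{pL}}/B^n_{\mathsf{pL}}$ for $n\ge1$, where $Z^n_{\mathsf{pL}}$ is the kernel of $\delta_{\mathsf{pL}}:C^n_{\mathsf{pL}}(\mathfrak{a},\mathfrak{a})\to C^{n+1}_{\mathsf{pL}}(\mathfrak{a},\mathfrak{a})$, $B^1_{\mathsf{pL}}=0$, $B^{n+1}_{\mathsf{pL}}=\delta_{\mathsf{pL}}(C^n_{\mathsf{pL}}(\mathfrak{a},\mathfrak{a}))$, and $$\begin{aligned}(\delta_{\mathsf{pL}}f)([r];x_1,\dots,x_{n+1})=&\sum_{i=1}^n(-1)^{i+1}\pi\big(R^{\sigma_i}_{2;2,n}[r];x_i,f(S^{\sigma_i}_{2;2,n}[r];x_1,\dots,\widehat{x_i},\dots,x_{n+1})\big)\\&+(-1)^{n+1}\pi\big(R^{\mathrm{id}}_{2;1,n}[r];f(S^{\mathrm{id}}_{2;1,n}[r];x_1,\dots,x_n),x_{n+1}\big)\\&+\sum_{1\le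 i<j\le n+1}(-1)^i f\big(R^{\sigma_{i,j}}_{n;j-1,2}[r];x_1,\dots,\widehat{x_i},\dots,x_{j-1},\pi(S^{\sigma_{i,j}}_{n;j-1,2}[r];x_i,x_j),x_{j+1},\dots,x_{n+1}\big).\end{aligned}$$ Here $\sigma_i\in Sh(1,n-1)$ is the shuffle with $\sigma_i(1)=i$, and $\sigma_{i,j}\in Sh(j-2,1)$ is the shuffle with $\sigma_{i,j}(j-1)=i$. Theorem. Let $(\mathfrak{a},\triangleleft,\triangleright)$ be a pre-Leibniz algebra over $\mathbf{k}$. Give $C^{p+1}_{\mathsf{pL}}(\mathfrak{a},\mathfrak{a})$ and $H^{p+1}_{\mathsf{pL}}(\mathfrak{a},\mathfrak{a})$ the degree $p\ge 0$. Then: 1. $(C^{*+1}_{\mathsf{pL}}(\mathfrak{a},\mathfrak{a}),\llbracket\,,\rrbracket_{\mathsf{pL}},d_\pi)$ is a differential graded Lie algebra. 2. $\delta_{\mathsf{pL}}f=(-1)^{n-1}d_\pi f$ for $f\in C^n_{\mathsf{pL}}(\mathfrak{a},\mathfrak{a})$, and $B^n_{\mathsf{pL}}\subseteq Z^n_{\mathsf{pL}}$,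 for all $n\geq 1$. 3. If $f$ and $g$ are cocycles, so is $\llbracket f,g\rrbracket_{\mathsf{pL}}$; and there is a unique graded Lie algebra structure on $H^{*+1}_{\mathsf{pL}}(\mathfrak{a},\mathfrak{a})$ whose bracket satisfies $\big[[f],[g]\big]=\big[\llbracket f,g\rrbracket_{\mathsf{pL}}\big]$ for all cocycles $f,g$. -/

import Mathlib

noncomputable section

namespace PreLeib

/-! ### Pre-Leibniz algebras and their representations -/

/-- A (left) pre-Leibniz algebra structure on the vector space `a`:
`lt x y` is `x ◁ y` and `rt x y` is `x ▷ y`. -/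
structure PreLeibniz (k a : Type*) [Field k] [AddCommGroup a] [Module k a] where
  lt : a →ₗ[k] a →ₗ[k] a
  rt : a →ₗ[k] a →ₗ[k] a
  iden₁ : ∀ x y z, lt x (lt y z + rt y z) = lt (lt x y) z + rt y (lt x z)
  iden₂ : ∀ x y z, rt x (lt y z) = lt (rt x y) z + lt y (lt x z + rt x z)
  iden₃ : ∀ x y z, rt x (rt y z) = rt (lt x y + rt x y) z + rt y (rt x z)

/-- A representation of a pre-Leibniz algebra on the vector space `M`. The nine identities are the
three defining identities of a pre-Leibniz algebra with exactly one of `x, y, z` replaced by an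
element `u` of `M`. -/
structure Rep {k a : Type*} [Field k] [AddCommGroup a] [Module k a] (A : PreLeibniz k a)
    (M : Type*) [AddCommGroup M] [Module k M] where
  ltL : a →ₗ[k] M →ₗ[k] M
  rtL : a →ₗ[k] M →ₗ[k] M
  ltR : M →ₗ[k] a →ₗ[k] M
  rtR : M →ₗ[k] a →ₗ[k] M
  iden₁x : ∀ u y z, ltR u (A.lt y z + A.rt y z) = ltR (ltR u y) z + rtL y (ltR u z)
  iden₁y : ∀ x u z, ltL x (ltR u z + rtR u z) = ltR (ltL x u) z + rtR u (A.lt x z)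
  iden₁z : ∀ x y u, ltL x (ltL y u + rtL y u) = ltL (A.lt x y) u + rtL y (ltL x u)
  iden₂x : ∀ u y z, rtR u (A.lt y z) = ltR (rtR u y) z + ltL y (ltR u z + rtR u z)
  iden₂y : ∀ x u z, rtL x (ltR u z) = ltR (rtL x u) z + ltR u (A.lt x z + A.rt x z)
  iden₂z : ∀ x y u, rtL x (ltL y u) = ltL (A.rt x y) u + ltL y (ltL x u + rtL x u)
  iden₃x : ∀ u y z, rtR u (A.rt y z) = rtR (ltR u y + rtR u y) z + rtL y (rtR u z)
  iden₃y : ∀ x u z, rtL x (rtR u z) = rtR (ltL x u + rtL x u) z + rtR u (A.rt x z)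
  iden₃z : ∀ x y u, rtL x (rtL y u) = rtL (A.lt x y + A.rt x y) u + rtL y (rtL x u)

/-- The adjoint representation. -/
def adjoint {k a : Type*} [Field k] [AddCommGroup a] [Module k a] (A : PreLeibniz k a) :
    Rep A a where
  ltL := A.lt
  rtL := A.rt
  ltR := A.lt
  rtR := A.rt
  iden₁x := A.iden₁
  iden₁y := A.iden₁
  iden₁z := A.iden₁
  iden₂x := A.iden₂
  iden₂y := A.iden₂
  iden₂z := A.iden₂
  iden₃x := A.iden₃
  iden₃y := A.iden₃
  iden₃z := A.iden₃

/-! ### Cochains -/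

/-- `Hom (k[C_n] ⊗ a^{⊗ n}, M)`. The set `C_n = {[1], …, [n]}` is `Fin n`, so that `[r]` is
`r - 1 : Fin n`, and `f (Finsupp.single r 1) x` is `f ([r]; x_1, …, x_n)`. -/
abbrev Cochain (k a M : Type*) [Field k] [AddCommGroup a] [Module k a]
    [AddCommGroup M] [Module k M] (n : ℕ) :=
  (Fin n →₀ k) →ₗ[k] MultilinearMap k (fun _ : Fin n => a) M

instance (k a M : Type*) [Field k] [AddCommGroup a] [Module k a]
    [AddCommGroup M] [Module k M] (n : ℕ) : AddCommGroup (Cochain k a M n) :=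
  LinearMap.addCommGroup

instance (k a M : Type*) [Field k] [AddCommGroup a] [Module k a]
    [AddCommGroup M] [Module k M] (n : ℕ) : Module k (Cochain k a M n) :=
  LinearMap.module

/-! ### Shuffles and boxes

Everything is indexed by the shifted degree: the arities are `m = p + 1`, `n = q + 1` and
`m + n - 1 = r + 1` where `p + q = r`. Positions, boxes and elements are counted from `0`. -/

/-- `Sh (i, q)`: the permutations of the first `i + q` elements that are increasing on the first
`i` and on the following `q` elements. They are regarded as permutations of all `N ≥ i + q`
elements that fix the remaining elements. -/
def shuffles (N i q : ℕ) : Finset (Equiv.Perm (Fin N)) :=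
  Finset.univ.filter fun σ =>
    (∀ s t : Fin N, s < t → (t : ℕ) < i → σ s < σ t) ∧
    (∀ s t : Fin N, i ≤ (s : ℕ) → s < t → (t : ℕ) < i + q → σ s < σ t) ∧
    (∀ t : Fin N, i + q ≤ (t : ℕ) → σ t = t)

section Boxes

variable {p q r : ℕ}

/-- The sequence `σ 0, σ 1, …, σ r` is cut into `p + 1` boxes, of which box `i` has `q + 1` elements
and every other box has one. This is the number of the box that contains the `t`-th entry. -/
def box (h : p + q = r) (i : Fin (p + 1)) (t : Fin (r + 1)) : Fin (p + 1) :=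
  if ht : (t : ℕ) < i then ⟨t, by omega⟩
  else if (t : ℕ) ≤ i + q then i
  else ⟨t - q, by omega⟩

/-- The map `R^σ_{m; i, n} : C_{m + n - 1} → C_m`: the number of the box in which `c` appears. -/
def R (h : p + q = r) (i : Fin (p + 1)) (σ : Equiv.Perm (Fin (r + 1))) (c : Fin (r + 1)) :
    Fin (p + 1) :=
  box h i (σ.symm c)

/-- The map `S^σ_{m; i, n} : C_{m + n - 1} → k[C_n]`: the place of `c` inside box `i` if `c` appears
there, and the sum of all the elements of `C_n` otherwise. -/
def S (k : Type*) [Field k] (_h : p + q = r) (i : Fin (p + 1)) (σ : Equiv.Perm (Fin (r + 1)))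
    (c : Fin (r + 1)) : Fin (q + 1) →₀ k :=
  if hc : (i : ℕ) ≤ σ.symm c ∧ (σ.symm c : ℕ) ≤ i + q then
    Finsupp.single ⟨(σ.symm c : ℕ) - i, by omega⟩ 1
  else ∑ j : Fin (q + 1), Finsupp.single j 1

variable {k a M : Type*} [Field k] [AddCommGroup a] [Module k a] [AddCommGroup M] [Module k M]

/-- The `p + 1` arguments
`x_{σ 0}, …, x_{σ (i-1)}, G (x_{σ i}, …, x_{σ (i+q)}), x_{σ (i+q+1)}, …, x_{σ r}`. -/
def insertArgs (h : p + q = r) (i : Fin (p + 1)) (σ : Equiv.Perm (Fin (r + 1)))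
    (G : MultilinearMap k (fun _ : Fin (q + 1) => a) a) (x : Fin (r + 1) → a) :
    Fin (p + 1) → a := fun l =>
  if l < i then x (σ ⟨l, by omega⟩)
  else if l = i then G fun j => x (σ ⟨i + j, by omega⟩)
  else x (σ ⟨l + q, by omega⟩)

theorem insertArgs_eq (h : p + q = r) (i : Fin (p + 1)) (σ : Equiv.Perm (Fin (r + 1)))
    (G : MultilinearMap k (fun _ : Fin (q + 1) => a) a) (x : Fin (r + 1) → a) :
    insertArgs h i σ G x = Function.update
      (insertArgs h i σ (0 : MultilinearMap k (fun _ : Fin (q + 1) => a) a) x) i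
      (G fun j => x (σ ⟨i + j, by omega⟩)) := by
  funext l
  by_cases hl : l = i
  · subst hl; simp [insertArgs]
  · simp [insertArgs, hl]

/-- Replacing the `t`-th entry of the sequence outside of box `i`. -/
theorem insertArgs_update_of_ne (h : p + q = r) (i : Fin (p + 1)) (σ : Equiv.Perm (Fin (r + 1)))
    (G : MultilinearMap k (fun _ : Fin (q + 1) => a) a) (x : Fin (r + 1) → a) (t : Fin (r + 1))
    (ht : ¬ ((i : ℕ) ≤ t ∧ (t : ℕ) ≤ i + q)) (v : a) :
    insertArgs h i σ G (Function.update x (σ t) v) =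
      Function.update (insertArgs h i σ G x) (box h i t) v := by
  funext l
  have hb : (box h i t : ℕ) = if (t : ℕ) < i then (t : ℕ) else t - q := by
    unfold box
    split_ifs <;> first | rfl | (exfalso; omega)
  by_cases hl : l = box h i t
  · have hlv : (l : ℕ) = if (t : ℕ) < i then (t : ℕ) else t - q := by rw [hl, hb]
    rw [← hl, Function.update_self]
    unfold insertArgs
    split_ifs at hlv with hti
    · have h1 : l < i := by rw [Fin.lt_def]; omega
      have h2 : (⟨l, by omega⟩ : Fin (r + 1)) = t := Fin.ext hlv
      rw [if_pos h1, h2, Function.update_self]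
    · have h1 : ¬ l < i := by rw [Fin.lt_def]; omega
      have h3 : ¬ l = i := by rw [Fin.ext_iff]; omega
      have h2 : (⟨l + q, by omega⟩ : Fin (r + 1)) = t := Fin.ext (by simp only; omega)
      rw [if_neg h1, if_neg h3, h2, Function.update_self]
  · rw [Function.update_of_ne hl]
    have hlv : (l : ℕ) ≠ if (t : ℕ) < i then (t : ℕ) else t - q := by
      rw [← hb]; exact fun e => hl (Fin.ext e)
    have key : ∀ s : Fin (r + 1), s ≠ t → Function.update x (σ t) v (σ s) = x (σ s) :=
      fun s hs => Function.update_of_ne (fun e => hs (σ.injective e)) _ _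
    unfold insertArgs
    by_cases h1 : l < i
    · rw [if_pos h1, if_pos h1, key]
      intro e
      have := Fin.ext_iff.1 e
      rw [Fin.lt_def] at h1
      simp only at this
      split_ifs at hlv <;> omega
    · rw [if_neg h1, if_neg h1]
      by_cases h3 : l = i
      · rw [if_pos h3, if_pos h3]
        congr 1
        funext j
        rw [key]
        intro e
        have := Fin.ext_iff.1 e
        simp only at this
        omega
      · rw [if_neg h3, if_neg h3, key]
        intro e
        have := Fin.ext_iff.1 e
        rw [Fin.lt_def] at h1
        rw [Fin.ext_iff] at h3
        simp only at this
        split_ifs at hlv <;> omega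

/-- Replacing the `t`-th entry of the sequence inside of box `i`. -/
theorem insertArgs_update_of_mem (h : p + q = r) (i : Fin (p + 1)) (σ : Equiv.Perm (Fin (r + 1)))
    (G : MultilinearMap k (fun _ : Fin (q + 1) => a) a) (x : Fin (r + 1) → a) (t : Fin (r + 1))
    (ht : (i : ℕ) ≤ t ∧ (t : ℕ) ≤ i + q) (v : a) :
    insertArgs h i σ G (Function.update x (σ t) v) =
      Function.update (insertArgs h i σ G x) i
        (G (Function.update (fun j : Fin (q + 1) => x (σ ⟨i + j, by omega⟩))
          ⟨t - i, by omega⟩ v)) := by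
  have key : ∀ s : Fin (r + 1), s ≠ t → Function.update x (σ t) v (σ s) = x (σ s) :=
    fun s hs => Function.update_of_ne (fun e => hs (σ.injective e)) _ _
  funext l
  by_cases hl : l = i
  · subst hl
    rw [Function.update_self]
    simp only [insertArgs, lt_irrefl, if_false, if_true]
    congr 1
    funext j
    by_cases hj : j = ⟨t - l, by omega⟩
    · have h2 : (⟨l + j, by omega⟩ : Fin (r + 1)) = t := by
        subst hj; exact Fin.ext (by simp only; omega)
      rw [h2, ← hj, Function.update_self, Function.update_self]
    · rw [Function.update_of_ne hj, key]
      intro e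
      have := Fin.ext_iff.1 e
      simp only at this
      exact hj (Fin.ext (by simp only; omega))
  · rw [Function.update_of_ne hl]
    unfold insertArgs
    rw [Fin.ext_iff] at hl
    by_cases h1 : l < i
    · rw [if_pos h1, if_pos h1, key]
      intro e
      have := Fin.ext_iff.1 e
      rw [Fin.lt_def] at h1
      simp only at this
      omega
    · have h3 : ¬ l = i := by rw [Fin.ext_iff]; exact hl
      rw [if_neg h1, if_neg h1, if_neg h3, if_neg h3, key]
      intro e
      have := Fin.ext_iff.1 e
      rw [Fin.lt_def] at h1
      simp only at this
      omega

/-- The multilinear map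
`F (x_{σ 0}, …, x_{σ (i-1)}, G (x_{σ i}, …, x_{σ (i+q)}), x_{σ (i+q+1)}, …, x_{σ r})`. -/
def insertion (h : p + q = r) (i : Fin (p + 1)) (σ : Equiv.Perm (Fin (r + 1)))
    (F : MultilinearMap k (fun _ : Fin (p + 1) => a) M)
    (G : MultilinearMap k (fun _ : Fin (q + 1) => a) a) :
    MultilinearMap k (fun _ : Fin (r + 1) => a) M :=
  MultilinearMap.mk' (fun x => F (insertArgs h i σ G x))
    (by
      intro x s v w
      obtain ⟨t, rfl⟩ := σ.surjective s
      by_cases ht : (i : ℕ) ≤ t ∧ (t : ℕ) ≤ i + q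
      · simp only [insertArgs_update_of_mem h i σ G x t ht, MultilinearMap.map_update_add]
      · simp only [insertArgs_update_of_ne h i σ G x t ht, MultilinearMap.map_update_add])
    (by
      intro x s c v
      obtain ⟨t, rfl⟩ := σ.surjective s
      by_cases ht : (i : ℕ) ≤ t ∧ (t : ℕ) ≤ i + q
      · simp only [insertArgs_update_of_mem h i σ G x t ht, MultilinearMap.map_update_smul]
      · simp only [insertArgs_update_of_ne h i σ G x t ht, MultilinearMap.map_update_smul])

@[simp] theorem insertion_apply (h : p + q = r) (i : Fin (p + 1)) (σ : Equiv.Perm (Fin (r + 1)))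
    (F : MultilinearMap k (fun _ : Fin (p + 1) => a) M)
    (G : MultilinearMap k (fun _ : Fin (q + 1) => a) a) (x : Fin (r + 1) → a) :
    insertion h i σ F G x = F (insertArgs h i σ G x) := rfl

/-- `insertion` is bilinear. -/
def insertionₗ (h : p + q = r) (i : Fin (p + 1)) (σ : Equiv.Perm (Fin (r + 1))) :
    MultilinearMap k (fun _ : Fin (p + 1) => a) M →ₗ[k]
      MultilinearMap k (fun _ : Fin (q + 1) => a) a →ₗ[k]
        MultilinearMap k (fun _ : Fin (r + 1) => a) M :=
  LinearMap.mk₂ k (insertion h i σ)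
    (fun _ _ _ => MultilinearMap.ext fun _ => rfl)
    (fun _ _ _ => MultilinearMap.ext fun _ => rfl)
    (fun F G₁ G₂ => MultilinearMap.ext fun x => by
      simp only [insertion_apply, _root_.add_apply]
      rw [insertArgs_eq h i σ (G₁ + G₂), insertArgs_eq h i σ G₁, insertArgs_eq h i σ G₂,
        _root_.add_apply, MultilinearMap.map_update_add])
    (fun c F G => MultilinearMap.ext fun x => by
      simp only [insertion_apply, _root_.smul_apply]
      rw [insertArgs_eq h i σ (c • G), insertArgs_eq h i σ G,
        _root_.smul_apply, MultilinearMap.map_update_smul])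

end Boxes

/-! ### The graded Lie bracket on cochains -/

section Bracket

variable {p q r : ℕ} {k a : Type*} [Field k] [AddCommGroup a] [Module k a]

/-- The cochain `f ⋄_i g`:
`(f ⋄_i g) ([c]; x) = ∑_σ (-1)^σ f (R^σ [c]; x_{σ 0}, …, g (S^σ [c]; x_{σ i}, …), …, x_r)`,
the sum being over the shuffles `σ ∈ Sh (i, q)`. -/
def diamond (h : p + q = r) (i : Fin (p + 1)) (f : Cochain k a a (p + 1))
    (g : Cochain k a a (q + 1)) : Cochain k a a (r + 1) :=
  Finsupp.linearCombination k fun c =>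
    ∑ σ ∈ shuffles (r + 1) i q,
      ((Equiv.Perm.sign σ : ℤ) : k) •
        insertionₗ h i σ (f (Finsupp.single (R h i σ c) 1)) (g (S k h i σ c))

/-- `diamond` is bilinear. -/
def diamondₗ (k a : Type*) [Field k] [AddCommGroup a] [Module k a]
    (h : p + q = r) (i : Fin (p + 1)) :
    Cochain k a a (p + 1) →ₗ[k] Cochain k a a (q + 1) →ₗ[k] Cochain k a a (r + 1) :=
  LinearMap.mk₂ k (diamond h i)
    (fun f₁ f₂ g => by
      ext c : 2
      simp [diamond, Finset.sum_add_distrib])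
    (fun s f g => by
      ext c : 2
      simp [diamond, Finset.smul_sum, smul_comm s])
    (fun f g₁ g₂ => by
      ext c : 2
      simp [diamond, Finset.sum_add_distrib])
    (fun s f g => by
      ext c : 2
      simp [diamond, Finset.smul_sum, smul_comm s])

end Bracket

/-- A family of bilinear maps of degree zero on a graded vector space `⊕_{p ≥ 0} L p`. The target
degree `r` with `p + q = r` is a variable of its own in order to avoid transports. -/
abbrev GradedBilin (k : Type*) [Field k] (L : ℕ → Type*) [∀ p, AddCommGroup (L p)]
    [∀ p, Module k (L p)] :=
  ∀ p q r : ℕ, p + q = r → L p →ₗ[k] L q →ₗ[k] L r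

/-- The bracket
`⟦f, g⟧ = ∑_i (-1)^{(i-1)(n-1)} f ⋄_i g - (-1)^{(m-1)(n-1)} ∑_i (-1)^{(i-1)(m-1)} g ⋄_i f`
for `f` of arity `m = p + 1` and `g` of arity `n = q + 1`; here `i` counts from `0`. -/
def plBracket (k a : Type*) [Field k] [AddCommGroup a] [Module k a] :
    GradedBilin k (fun p => Cochain k a a (p + 1)) := fun p q _ h =>
  (∑ i : Fin (p + 1), (-1 : k) ^ ((i : ℕ) * q) • diamondₗ k a h i) -
    (-1 : k) ^ (p * q) •
      ∑ i : Fin (q + 1), (-1 : k) ^ ((i : ℕ) * p) •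
        (diamondₗ k a ((Nat.add_comm q p).trans h) i).flip

/-! ### (Differential) graded Lie algebras -/

/-- The bilinear family `br` makes `⊕_{p ≥ 0} L p` into a graded Lie algebra: graded skew-symmetry
and the graded Jacobi identity. -/
structure IsGradedLie {k : Type*} [Field k] {L : ℕ → Type*} [∀ p, AddCommGroup (L p)]
    [∀ p, Module k (L p)] (br : GradedBilin k L) : Prop where
  skew : ∀ (p q r : ℕ) (h : p + q = r) (h' : q + p = r) (x : L p) (y : L q),
    br p q r h x y = -((-1 : k) ^ (p * q) • br q p r h' y x)
  jacobi : ∀ (p q s pq qs ps t : ℕ) (hpq : p + q = pq) (hqs : q + s = qs) (hps : p + s = ps)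
    (h₁ : p + qs = t) (h₂ : pq + s = t) (h₃ : q + ps = t) (x : L p) (y : L q) (z : L s),
    br p qs t h₁ x (br q s qs hqs y z) =
      br pq s t h₂ (br p q pq hpq x y) z +
        (-1 : k) ^ (p * q) • br q ps t h₃ y (br p s ps hps x z)

/-- The bilinear family `br` and the degree one maps `d` make `⊕_{p ≥ 0} L p` into a differential
graded Lie algebra. -/
structure IsDGLie {k : Type*} [Field k] {L : ℕ → Type*} [∀ p, AddCommGroup (L p)]
    [∀ p, Module k (L p)] (br : GradedBilin k L) (d : ∀ p, L p →ₗ[k] L (p + 1)) : Prop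
    extends IsGradedLie br where
  d_d : ∀ (p : ℕ) (x : L p), d (p + 1) (d p x) = 0
  d_br : ∀ (p q r : ℕ) (h : p + q = r) (h₁ : p + 1 + q = r + 1) (h₂ : p + (q + 1) = r + 1)
    (x : L p) (y : L q),
    d r (br p q r h x y) =
      br (p + 1) q (r + 1) h₁ (d p x) y + (-1 : k) ^ p • br p (q + 1) (r + 1) h₂ x (d q y)

section Algebra

variable {k a : Type*} [Field k] [AddCommGroup a] [Module k a]

/-- A bilinear map as a multilinear map of two arguments. -/
def bilin (b : a →ₗ[k] a →ₗ[k] a) : MultilinearMap k (fun _ : Fin 2 => a) a :=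
  MultilinearMap.mk' (fun x => b (x 0) (x 1))
    (by
      intro x i v w
      fin_cases i <;> simp)
    (by
      intro x i c v
      fin_cases i <;> simp)

/-- The cochain `π` with `π ([1]; x, y) = x ◁ y` and `π ([2]; x, y) = x ▷ y`. -/
def PreLeibniz.π (A : PreLeibniz k a) : Cochain k a a 2 :=
  Finsupp.linearCombination k ![bilin A.lt, bilin A.rt]

/-- The differential `d_π = ⟦π, -⟧`. -/
def PreLeibniz.dπ (A : PreLeibniz k a) (p : ℕ) :
    Cochain k a a (p + 1) →ₗ[k] Cochain k a a (p + 1 + 1) :=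
  plBracket k a 1 p (p + 1) (Nat.add_comm 1 p) A.π

end Algebra

/-! ### Cohomology of a pre-Leibniz algebra with coefficients in a representation -/

section Cohomology

variable {k a M : Type*} [Field k] [AddCommGroup a] [Module k a] [AddCommGroup M] [Module k M]
  {A : PreLeibniz k a}

/-- `π^L ([1]; x, u) = x ◁^L u` and `π^L ([2]; x, u) = x ▷^L u`. -/
def Rep.πL (ρ : Rep A M) : Fin 2 → a →ₗ[k] M →ₗ[k] M := ![ρ.ltL, ρ.rtL]

/-- `π^R ([1]; u, x) = u ◁^R x` and `π^R ([2]; u, x) = u ▷^R x`. -/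
def Rep.πR (ρ : Rep A M) : Fin 2 → M →ₗ[k] a →ₗ[k] M := ![ρ.ltR, ρ.rtR]

/-- The multilinear map `b (x_i, F (x_0, …, x̂_i, …, x_n))`. -/
def leftTerm {n : ℕ} (b : a →ₗ[k] M →ₗ[k] M) (i : Fin (n + 1))
    (F : MultilinearMap k (fun _ : Fin n => a) M) :
    MultilinearMap k (fun _ : Fin (n + 1) => a) M :=
  MultilinearMap.mk' (fun x => b (x i) (F fun j => x (i.succAbove j)))
    (by
      intro x s v w
      rcases Fin.eq_self_or_eq_succAbove i s with rfl | ⟨j, rfl⟩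
      · simp [Fin.succAbove_ne]
      · have e : ∀ u : a, (fun l => Function.update x (i.succAbove j) u (i.succAbove l)) =
            Function.update (fun l => x (i.succAbove l)) j u := fun u =>
          Function.update_comp_eq_of_injective x i.succAbove_right_injective j u
        simp only [e, Function.update_of_ne (Fin.succAbove_ne i j).symm,
          MultilinearMap.map_update_add, map_add])
    (by
      intro x s c v
      rcases Fin.eq_self_or_eq_succAbove i s with rfl | ⟨j, rfl⟩
      · simp [Fin.succAbove_ne]
      · have e : ∀ u : a, (fun l => Function.update x (i.succAbove j) u (i.succAbove l)) =
            Function.update (fun l => x (i.succAbove l)) j u := fun u =>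
          Function.update_comp_eq_of_injective x i.succAbove_right_injective j u
        simp only [e, Function.update_of_ne (Fin.succAbove_ne i j).symm,
          MultilinearMap.map_update_smul, map_smul])

/-- `leftTerm` is linear in the cochain. -/
def leftTermₗ {n : ℕ} (b : a →ₗ[k] M →ₗ[k] M) (i : Fin (n + 1)) :
    MultilinearMap k (fun _ : Fin n => a) M →ₗ[k]
      MultilinearMap k (fun _ : Fin (n + 1) => a) M where
  toFun := leftTerm b i
  map_add' F G := MultilinearMap.ext fun x => by simp [leftTerm]
  map_smul' c F := MultilinearMap.ext fun x => by simp [leftTerm]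

@[simp] theorem leftTermₗ_apply {n : ℕ} (b : a →ₗ[k] M →ₗ[k] M) (i : Fin (n + 1))
    (F : MultilinearMap k (fun _ : Fin n => a) M) (x : Fin (n + 1) → a) :
    leftTermₗ b i F x = b (x i) (F fun j => x (i.succAbove j)) := rfl

/-- The multilinear map `b (F (x_0, …, x_{n-1}), x_n)`. -/
def rightTermₗ {n : ℕ} (b : M →ₗ[k] a →ₗ[k] M) :
    MultilinearMap k (fun _ : Fin n => a) M →ₗ[k]
      MultilinearMap k (fun _ : Fin (n + 1) => a) M :=
  leftTermₗ b.flip (Fin.last n)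

@[simp] theorem rightTermₗ_apply {n : ℕ} (b : M →ₗ[k] a →ₗ[k] M)
    (F : MultilinearMap k (fun _ : Fin n => a) M) (x : Fin (n + 1) → a) :
    rightTermₗ b F x = b (F fun j => x j.castSucc) (x (Fin.last n)) := by
  simp [rightTermₗ]

/-- The shuffle `i, 0, 1, …, î, …, n`. -/
def frontShuffle {n : ℕ} (i : Fin (n + 1)) : Equiv.Perm (Fin (n + 1)) := i.cycleRange.symm

/-- The shuffle `0, …, i-1, i+1, …, l, i, l+1, …, n` (for `i ≤ l`). -/
def moveShuffle {n : ℕ} (i l : Fin (n + 1)) : Equiv.Perm (Fin (n + 1)) := Fin.cycleIcc i l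

/-- The value on `[c]` of the coboundary `δ f` of a cochain `f` of arity `n = p + 1`. Counting from
`1`, the three summands are
`∑_{i = 1}^{n} (-1)^{i+1} π^L (R [c]; x_i, f (S [c]; x_1, …, x̂_i, …, x_{n+1}))`,
where the boxes are `[i]` and `[1] … [î] … [n+1]`,
`(-1)^{n+1} π^R (R [c]; f (S [c]; x_1, …, x_n), x_{n+1})`,
where the boxes are `[1] … [n]` and `[n+1]`, and
`∑_{1 ≤ i < j ≤ n+1}
  (-1)^i f (R [c]; x_1, …, x̂_i, …, x_{j-1}, π (S [c]; x_i, x_j), x_{j+1}, …, x_{n+1})`,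
where the boxes are `[1], …, [j-1]` without `[i]`, then `[i] [j]`, then `[j+1], …, [n+1]`.
In the code `l` is `j - 1`. -/
def coboundaryAux (ρ : Rep A M) (p : ℕ) (f : Cochain k a M (p + 1)) (c : Fin (p + 1 + 1)) :
    MultilinearMap k (fun _ : Fin (p + 1 + 1) => a) M :=
  (∑ i : Fin (p + 1), (-1 : k) ^ (i : ℕ) •
    leftTermₗ
      (ρ.πL (R (Nat.add_comm 1 p) 1 (frontShuffle i.castSucc) c)) i.castSucc
      (f (S k (Nat.add_comm 1 p) 1 (frontShuffle i.castSucc) c)))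
  + (-1 : k) ^ p •
    rightTermₗ (ρ.πR (R (Nat.add_comm 1 p) 0 1 c)) (f (S k (Nat.add_comm 1 p) 0 1 c))
  + ∑ l : Fin (p + 1), ∑ i ∈ Finset.Iic l, (-1 : k) ^ ((i : ℕ) + 1) •
    insertionₗ (rfl : p + 1 = p + 1) l (moveShuffle i.castSucc l.castSucc)
      (f (Finsupp.single (R (rfl : p + 1 = p + 1) l (moveShuffle i.castSucc l.castSucc) c) 1))
      (A.π (S k (rfl : p + 1 = p + 1) l (moveShuffle i.castSucc l.castSucc) c))

/-- The coboundary `δ : C^{p+1} (a, M) → C^{p+2} (a, M)`. -/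
def coboundary (ρ : Rep A M) (p : ℕ) :
    Cochain k a M (p + 1) →ₗ[k] Cochain k a M (p + 1 + 1) where
  toFun f := Finsupp.linearCombination k (coboundaryAux ρ p f)
  map_add' f g := by
    ext c : 2
    simp only [coboundaryAux, LinearMap.add_apply, map_add, smul_add, Finset.sum_add_distrib,
      LinearMap.comp_apply, Finsupp.lsingle_apply, Finsupp.linearCombination_single]
    abel
  map_smul' s f := by
    ext c : 2
    simp only [coboundaryAux, LinearMap.smul_apply, map_smul, smul_comm s, Finset.smul_sum,
      LinearMap.comp_apply, Finsupp.lsingle_apply, Finsupp.linearCombination_single, smul_add,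
      RingHom.id_apply]

/-- The cocycles `Z^{p+1} (a, M)`. -/
def cocycles (ρ : Rep A M) (p : ℕ) : Submodule k (Cochain k a M (p + 1)) :=
  LinearMap.ker (coboundary ρ p)

/-- The coboundaries `B^{p+1} (a, M)`; the complex starts in arity one, hence `B^1 = 0`. -/
def coboundaries (ρ : Rep A M) : (p : ℕ) → Submodule k (Cochain k a M (p + 1))
  | 0 => ⊥
  | p + 1 => LinearMap.range (coboundary ρ p)

/-- The cohomology `H^{p+1} (a, M) = Z^{p+1} (a, M) / B^{p+1} (a, M)`. -/
abbrev Cohomology (ρ : Rep A M) (p : ℕ) :=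
  cocycles ρ p ⧸ (coboundaries ρ p).submoduleOf (cocycles ρ p)

/-- The class of a cocycle. -/
def cohomologyClass (ρ : Rep A M) (p : ℕ) : cocycles ρ p →ₗ[k] Cohomology ρ p :=
  Submodule.mkQ _

end Cohomology

end PreLeib

end

/-! The maps `R` and `S` encode a chain rule. A cochain `f` becomes a multilinear map `double f` on
a ⊕ εa (`double`): without ε its value is the sum of all f([c]; x), and its ε-part is the sum over c
of f([c]; ...) with ε carried by the c-th argument. When g is inserted into box i of f, an ε inside
the box passes through g at its place j, then through f at box i. An ε outside the box leaves g to
be evaluated without ε, and this value is the sum of all g([j]). These are the values of `S` and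
`R`, so `double` turns each f ⋄_i g into ordinary signed shuffle insertion (`double_diamond`). Since
`double` is injective (`double_injective`), identities may be checked for multilinear maps on a ⊕
εa, where the bracket is the one that governs Leibniz algebras.

For such maps the signed sum over all insertions and shuffles has a recursion in the first argument,
which goes either to f or to g. It is taken as the definition of `seqComp` and matched with the
shuffle sum in `sum_shuffleSum_insertArgs`. Induction along it shows that the associator is graded
symmetric in its last two entries (`seqAssoc_symm`), so the product `preLieProd` is graded right
pre-Lie and its commutator satisfies the graded Jacobi identity (`isGradedLie_plBracket`).

The three pre-Leibniz axioms say that a ⊕ εa is a Leibniz algebra, which gives π ∘ π = 0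
(`preLieProd_π_π`). Hence [π, π] = 0, and ⟦π, -⟧ is a derivation of square zero. Listing the
shuffles in Sh(1, p) and Sh(l, 1) identifies it with the coboundary up to sign (`coboundary_eq`).
The bracket of cohomology classes is then the usual quotient construction. -/

noncomputable section

namespace PreLeib

/-! ### Composition of functions of sequences -/

section SeqComp

variable {k V : Type*} [Field k] [AddCommGroup V] [Module k V]

/-- The sequence `x, X 0, X 1, …`. -/
def seqCons {V : Type*} (x : V) (X : ℕ → V) : ℕ → V
  | 0 => x
  | n + 1 => X n

theorem seqCons_head_tail {V : Type*} (X : ℕ → V) : seqCons (X 0) (fun j => X (j + 1)) = X := by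
  funext j
  cases j <;> rfl

/-- Fixing the first argument. -/
def contract {V : Type*} (x : V) (f : (ℕ → V) → V) : (ℕ → V) → V := fun X => f (seqCons x X)

/-- The signed sum over all insertions of `g`, of arity `n`, into `f`, of arity `m`, defined by
recursion on the number of arguments. -/
def seqComp (k : Type*) {V : Type*} [Field k] [AddCommGroup V] [Module k V] :
    ℕ → ℕ → ((ℕ → V) → V) → ((ℕ → V) → V) → (ℕ → V) → V
  | _, 0, f, g => contract (g 0) f
  | 0, _ + 1, _, _ => 0
  -- If the head goes to f, the box number drops by one, and the sign (-1)^{(i-1)(n-1)} of a map g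
  -- with n arguments loses the factor (-1)^{n-1}; in the present indexing this is (-1)^n. If it
  -- goes to g, the shuffle sign of moving it to the front of box i absorbs the change of that
  -- exponent, and no sign remains.
  | m + 1, n + 1, f, g => fun X =>
      (-1 : k) ^ n • seqComp k m (n + 1) (contract (X 0) f) g (fun j => X (j + 1)) +
        seqComp k (m + 1) n f (contract (X 0) g) (fun j => X (j + 1))

theorem seqComp_zero_right (m : ℕ) (f g : (ℕ → V) → V) :
    seqComp k m 0 f g = contract (g 0) f := by
  cases m <;> simp [seqComp]

theorem seqComp_zero_succ (n : ℕ) (f g : (ℕ → V) → V) :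
    seqComp k 0 (n + 1) f g = 0 := by
  simp [seqComp]

/-- The recursion in a form free of sequences. With `seqFun_ext` it reduces identities between
compositions to their contractions. -/
theorem contract_seqComp (m n : ℕ) (f g : (ℕ → V) → V) (x : V) :
    contract x (seqComp k (m + 1) (n + 1) f g) =
      (-1 : k) ^ n • seqComp k m (n + 1) (contract x f) g +
        seqComp k (m + 1) n f (contract x g) := by
  funext X
  simp only [contract, seqComp]
  rfl

theorem seqFun_ext {V : Type*} {f g : (ℕ → V) → V} (h : ∀ x, contract x f = contract x g) : f = g := by
  funext X
  rw [← seqCons_head_tail X]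
  exact congrFun (h (X 0)) _

theorem seqComp_add_left (m n : ℕ) (f₁ f₂ g : (ℕ → V) → V) :
    seqComp k m n (f₁ + f₂) g = seqComp k m n f₁ g + seqComp k m n f₂ g := by
  induction m, n, f₁, g using seqComp.induct generalizing f₂ with
  | case1 m f g => simp only [seqComp_zero_right]; rfl
  | case2 => simp [seqComp_zero_succ]
  | case3 m n f g ih₁ ih₂ =>
    refine seqFun_ext fun x => ?_
    have e : ∀ f g : (ℕ → V) → V, contract x (f + g) = contract x f + contract x g :=
      fun _ _ => rfl
    have h₁ := ih₁ (fun _ => x) (contract x f₂)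
    have h₂ := ih₂ (fun _ => x) f₂
    rw [e]
    simp only [contract_seqComp, e, h₁, h₂]
    module

theorem seqComp_smul_left (m n : ℕ) (c : k) (f g : (ℕ → V) → V) :
    seqComp k m n (c • f) g = c • seqComp k m n f g := by
  induction m, n, f, g using seqComp.induct with
  | case1 m f g => simp only [seqComp_zero_right]; rfl
  | case2 => simp [seqComp_zero_succ]
  | case3 m n f g ih₁ ih₂ =>
    refine seqFun_ext fun x => ?_
    have e : ∀ f : (ℕ → V) → V, contract x (c • f) = c • contract x f := fun _ => rfl
    have h₁ := ih₁ (fun _ => x)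
    have h₂ := ih₂ (fun _ => x)
    rw [e]
    simp only [contract_seqComp, e, h₁, h₂]
    module

theorem seqComp_zero_left (m n : ℕ) (g : (ℕ → V) → V) : seqComp k m n 0 g = 0 := by
  simpa using seqComp_smul_left m n (0 : k) 0 g

/-- Linearity in each of the first `m` arguments. -/
def SeqMultilinear (k : Type*) {V : Type*} [Field k] [AddCommGroup V] [Module k V] :
    ℕ → ((ℕ → V) → V) → Prop
  | 0, _ => True
  | m + 1, f => (∀ (c : k) (u v : V),
      contract (c • u + v) f = c • contract u f + contract v f) ∧
        ∀ x, SeqMultilinear k m (contract x f)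

/-- The value of g is fed into an argument of f, so linearity in g rests on the multilinearity of f,
whereas linearity in f is unconditional. -/
theorem seqComp_smul_add_right (m n : ℕ) (c : k) (f g₁ g₂ : (ℕ → V) → V)
    (hf : SeqMultilinear k (m + 1) f) :
    seqComp k (m + 1) n f (c • g₁ + g₂) =
      c • seqComp k (m + 1) n f g₁ + seqComp k (m + 1) n f g₂ := by
  induction n generalizing m f g₁ g₂ with
  | zero =>
    simp only [seqComp_zero_right]
    exact hf.1 c _ _
  | succ n ihn =>
    induction m generalizing f with
    | zero =>
      refine seqFun_ext fun x => ?_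
      have e : ∀ f g : (ℕ → V) → V, contract x (c • f + g) = c • contract x f + contract x g :=
        fun _ _ => rfl
      rw [e]
      simp only [contract_seqComp, e, ihn 0 f _ _ hf, seqComp_zero_succ]
      module
    | succ m ihm =>
      refine seqFun_ext fun x => ?_
      have e : ∀ f g : (ℕ → V) → V, contract x (c • f + g) = c • contract x f + contract x g :=
        fun _ _ => rfl
      rw [e]
      simp only [contract_seqComp, e, ihn (m + 1) f _ _ hf, ihm _ (hf.2 x)]
      module

theorem seqComp_zero_right_fun (m n : ℕ) (f : (ℕ → V) → V)
    (hf : SeqMultilinear k (m + 1) f) : seqComp k (m + 1) n f 0 = 0 := by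
  have := seqComp_smul_add_right m n (-1 : k) f 0 0 hf
  simpa using this

/-- The associator of `f`, `g`, `h` of arities `m`, `n + 1`, `s + 1`. -/
def seqAssoc (k : Type*) {V : Type*} [Field k] [AddCommGroup V] [Module k V] (m n s : ℕ)
    (f g h : (ℕ → V) → V) : (ℕ → V) → V :=
  seqComp k (m + n) (s + 1) (seqComp k m (n + 1) f g) h -
    seqComp k m (n + s + 1) f (seqComp k (n + 1) (s + 1) g h)

/-- The three summands record whether x goes to f, to g or to h. The last two are associators as
well, but they are written out because a contracted g or h may have arity zero, which `seqAssoc`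
excludes. -/
theorem contract_seqAssoc (m n s : ℕ) (f g h : (ℕ → V) → V)
    (hf : SeqMultilinear k (m + 1) f) (x : V) :
    contract x (seqAssoc k (m + 1) n s f g h) =
      (-1 : k) ^ (n + s) • seqAssoc k m n s (contract x f) g h +
      (-1 : k) ^ s • (seqComp k (m + n) (s + 1) (seqComp k (m + 1) n f (contract x g)) h -
        seqComp k (m + 1) (n + s) f (seqComp k n (s + 1) (contract x g) h)) +
      (seqComp k (m + n + 1) s (seqComp k (m + 1) (n + 1) f g) (contract x h) -
        seqComp k (m + 1) (n + s) f (seqComp k (n + 1) s g (contract x h))) := by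
  have e : ∀ f g : (ℕ → V) → V, contract x (f - g) = contract x f - contract x g :=
    fun _ _ => rfl
  unfold seqAssoc
  rw [e, show m + 1 + n = m + n + 1 by omega, contract_seqComp, contract_seqComp,
    contract_seqComp, contract_seqComp, seqComp_add_left, seqComp_smul_left,
    seqComp_smul_add_right _ _ _ _ _ _ hf, pow_add]
  module

/-- In the associator the nestings of h inside g inside f cancel, and what remains is the insertion
of g and h into different arguments of f, which is symmetric up to sign. Formally, after a
contraction the x-in-f terms match by induction, and the x-in-g terms of one side match the x-in-h
terms of the other. -/
theorem seqAssoc_symm (m n s : ℕ) (f g h : (ℕ → V) → V) (hf : SeqMultilinear k m f) :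
    seqAssoc k m n s f g h = (-1 : k) ^ (n * s) • seqAssoc k m s n f h g := by
  induction hN : m + n + s using Nat.strong_induction_on generalizing m n s f g h with
  | _ N ih =>
  cases m with
  | zero =>
    simp [seqAssoc, seqComp_zero_succ, seqComp_zero_left]
  | succ m =>
    -- Here `v` of arity n stands for the contraction of g or h. It is used twice, with the roles of
    -- g and h exchanged.
    have key : ∀ (n s : ℕ) (_ : m + 1 + n + s = N) (v h : (ℕ → V) → V),
        (seqComp k (m + n) (s + 1) (seqComp k (m + 1) n f v) h -
          seqComp k (m + 1) (n + s) f (seqComp k n (s + 1) v h)) =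
        (-1 : k) ^ (n * s + s) •
          (seqComp k (m + s + 1) n (seqComp k (m + 1) (s + 1) f h) v -
            seqComp k (m + 1) (s + n) f (seqComp k (s + 1) n h v)) := by
      intro n s hN v h
      cases n with
      | zero =>
        -- A constant `v` is substituted by contraction. The contraction of f ∘ h has a part with
        -- `v` inside h, which the subtracted term cancels; the part with `v` inside f carries
        -- (-1)^s, which cancels the sign in front.
        simp only [seqComp_zero_right, seqComp_zero_succ, add_zero, zero_mul,
          zero_add, contract_seqComp, seqComp_zero_right_fun _ _ _ hf]
        rw [sub_zero, add_sub_cancel_right, smul_smul, ← pow_add, ← two_mul, pow_mul]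
        simp
      | succ n =>
        have h₁ := ih (m + 1 + n + s) (by omega) (m + 1) n s f v h hf rfl
        unfold seqAssoc at h₁
        rw [show m + (n + 1) = m + 1 + n by omega, show n + 1 + s = n + s + 1 by omega,
          show m + s + 1 = m + 1 + s by omega, show s + (n + 1) = s + n + 1 by omega, h₁,
          show (n + 1) * s + s = n * s + 2 * s by ring, pow_add, pow_mul (-1 : k) 2 s]
        simp
    refine seqFun_ext fun x => ?_
    have e : ∀ (c : k) (f : (ℕ → V) → V), contract x (c • f) = c • contract x f :=
      fun _ _ => rfl
    rw [e, contract_seqAssoc _ _ _ _ _ _ hf, contract_seqAssoc _ _ _ _ _ _ hf,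
      ih (m + n + s) (by omega) m n s _ g h (hf.2 x) rfl, key n s hN, key s n (by omega)]
    have hs : (-1 : k) ^ s * (-1) ^ s = 1 := by rw [← mul_pow]; simp
    have hn : (-1 : k) ^ n * (-1) ^ n = 1 := by rw [← mul_pow]; simp
    have hns : (-1 : k) ^ (n * s) * (-1) ^ (n * s) = 1 := by rw [← mul_pow]; simp
    rw [mul_comm s n]
    simp only [pow_add]
    match_scalars
    · ring
    · linear_combination (-1 : k) ^ (n * s) * hs
    · linear_combination (-(-1 : k) ^ (n * s)) * hs
    · linear_combination (-1 : k) * hns - (-1 : k) ^ (n * s) * (-1) ^ (n * s) * hn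
    · linear_combination hns + (-1 : k) ^ (n * s) * (-1) ^ (n * s) * hn

end SeqComp

/-! ### Sums over shuffles -/

section Shuffles

/-- The permutation that sends `j` to `0` and is `τ` on the other places. -/
def permCons {N : ℕ} (j : Fin (N + 1)) (τ : Equiv.Perm (Fin N)) : Equiv.Perm (Fin (N + 1)) :=
  Equiv.Perm.decomposeFin.symm (0, τ) * j.cycleRange

theorem permCons_self {N : ℕ} (j : Fin (N + 1)) (τ : Equiv.Perm (Fin N)) :
    permCons j τ j = 0 := by
  simp [permCons]

theorem permCons_succAbove {N : ℕ} (j : Fin (N + 1)) (τ : Equiv.Perm (Fin N)) (t : Fin N) :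
    permCons j τ (j.succAbove t) = (τ t).succ := by
  simp [permCons]

theorem sign_permCons {N : ℕ} (j : Fin (N + 1)) (τ : Equiv.Perm (Fin N)) :
    Equiv.Perm.sign (permCons j τ) = (-1) ^ (j : ℕ) * Equiv.Perm.sign τ := by
  simp [permCons, mul_comm]

/-- A permutation σ is recovered from the place σ⁻¹ 0 of the smallest element and the order of the
others. -/
theorem permCons_bijective (N : ℕ) :
    Function.Bijective fun x : Fin (N + 1) × Equiv.Perm (Fin N) => permCons x.1 x.2 := by
  constructor
  · rintro ⟨j, τ⟩ ⟨j', τ'⟩ h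
    simp only at h
    have hj : j = j' := (permCons j τ).injective (by rw [permCons_self, h, permCons_self])
    subst hj
    have : τ = τ' := Equiv.ext fun t => Fin.succ_injective _ (by
      rw [← permCons_succAbove j, ← permCons_succAbove j, h])
    rw [this]
  · intro σ
    have h0 : (σ * (σ.symm 0).cycleRange⁻¹) 0 = 0 := by
      rw [Equiv.Perm.mul_apply, Equiv.Perm.inv_def, Fin.cycleRange_symm_zero,
        Equiv.apply_symm_apply]
    obtain ⟨⟨p, τ⟩, hτ⟩ := Equiv.Perm.decomposeFin.symm.surjective (σ * (σ.symm 0).cycleRange⁻¹)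
    have hp : p = 0 := by
      rw [← hτ, Equiv.Perm.decomposeFin_symm_apply_zero] at h0
      exact h0
    subst hp
    exact ⟨(σ.symm 0, τ), by simp [permCons, hτ]⟩

theorem val_succAbove {N : ℕ} (j : Fin (N + 1)) (t : Fin N) :
    (j.succAbove t : ℕ) = if (t : ℕ) < j then (t : ℕ) else t + 1 := by
  unfold Fin.succAbove
  simp only [Fin.lt_def, Fin.val_castSucc]
  split_ifs <;> rfl

theorem mem_shuffles {N i q : ℕ} {σ : Equiv.Perm (Fin N)} :
    σ ∈ shuffles N i q ↔
      (∀ s t : Fin N, s < t → (t : ℕ) < i → σ s < σ t) ∧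
      (∀ s t : Fin N, i ≤ (s : ℕ) → s < t → (t : ℕ) < i + q → σ s < σ t) ∧
      (∀ t : Fin N, i + q ≤ (t : ℕ) → σ t = t) := by
  simp [shuffles]

/-- The smallest element must open one of the two increasing blocks, so it stands at place 0 or at
place i; removing it leaves a shuffle with that block one shorter. Fixed places are excluded because
some block is nonempty. -/
theorem permCons_mem_shuffles {N i q : ℕ} (h0 : 0 < i + q) (hN : i + q ≤ N) (j : Fin (N + 1))
    (τ : Equiv.Perm (Fin N)) :
    permCons j τ ∈ shuffles (N + 1) i q ↔
      (0 < i ∧ (j : ℕ) = 0 ∧ τ ∈ shuffles N (i - 1) q) ∨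
      (0 < q ∧ (j : ℕ) = i ∧ τ ∈ shuffles N i (q - 1)) := by
  have hs := permCons_self j τ
  have ha := permCons_succAbove j τ
  have hv := val_succAbove j
  simp only [mem_shuffles]
  constructor
  · rintro ⟨h1, h2, h3⟩
    have hlt : (j : ℕ) < i + q := by
      by_contra hc
      have h := h3 j (by omega)
      rw [hs] at h
      rw [← h] at hc
      simp only [Fin.val_zero] at hc
      omega
    by_cases hji : (j : ℕ) < i
    · have hj0 : (j : ℕ) = 0 := by
        by_contra hc
        have h := h1 0 j (Fin.lt_def.2 (by simpa using Nat.pos_of_ne_zero hc)) hji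
        rw [hs] at h
        exact absurd h (Fin.not_lt_zero _)
      refine Or.inl ⟨by omega, hj0, ?_, ?_, ?_⟩
      · intro s t hst ht
        have h := h1 (j.succAbove s) (j.succAbove t) (Fin.succAbove_lt_succAbove_iff.2 hst)
          (by rw [hv]; split_ifs <;> omega)
        rwa [ha, ha, Fin.succ_lt_succ_iff] at h
      · intro s t hs hst ht
        have h := h2 (j.succAbove s) (j.succAbove t) (by rw [hv]; split_ifs <;> omega)
          (Fin.succAbove_lt_succAbove_iff.2 hst) (by rw [hv]; split_ifs <;> omega)
        rwa [ha, ha, Fin.succ_lt_succ_iff] at h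
      · intro t ht
        have h := h3 (j.succAbove t) (by rw [hv]; split_ifs <;> omega)
        rw [ha, Fin.ext_iff, hv, Fin.val_succ] at h
        rw [Fin.ext_iff]
        split_ifs at h <;> omega
    · have hj0 : (j : ℕ) = i := by
        by_contra hc
        have h := h2 ⟨i, by omega⟩ j le_rfl (Fin.lt_def.2 (by simp only; omega)) hlt
        rw [hs] at h
        exact absurd h (Fin.not_lt_zero _)
      refine Or.inr ⟨by omega, hj0, ?_, ?_, ?_⟩
      · intro s t hst ht
        have h := h1 (j.succAbove s) (j.succAbove t) (Fin.succAbove_lt_succAbove_iff.2 hst)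
          (by rw [hv]; split_ifs <;> omega)
        rwa [ha, ha, Fin.succ_lt_succ_iff] at h
      · intro s t hs hst ht
        have h := h2 (j.succAbove s) (j.succAbove t) (by rw [hv]; split_ifs <;> omega)
          (Fin.succAbove_lt_succAbove_iff.2 hst) (by rw [hv]; split_ifs <;> omega)
        rwa [ha, ha, Fin.succ_lt_succ_iff] at h
      · intro t ht
        have h := h3 (j.succAbove t) (by rw [hv]; split_ifs <;> omega)
        rw [ha, Fin.ext_iff, hv, Fin.val_succ] at h
        rw [Fin.ext_iff]
        split_ifs at h <;> omega
  · intro h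
    have hj : (j : ℕ) = 0 ∨ (j : ℕ) = i := by tauto
    refine ⟨?_, ?_, ?_⟩
    · intro s t hst ht
      rcases Fin.eq_self_or_eq_succAbove j s with hsj | ⟨s, rfl⟩ <;>
        rcases Fin.eq_self_or_eq_succAbove j t with htj | ⟨t, rfl⟩
      · exact absurd hst (by rw [hsj, htj]; exact lt_irrefl _)
      · rw [hsj, hs, ha]; exact Fin.succ_pos _
      · rw [htj] at hst ht
        rw [Fin.lt_def] at hst
        omega
      · rw [ha, ha, Fin.succ_lt_succ_iff]
        rw [hv] at ht
        rw [Fin.succAbove_lt_succAbove_iff] at hst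
        rcases h with ⟨h, hj, h1, -, -⟩ | ⟨h, hj, h1, -, -⟩
        · exact h1 s t hst (by split_ifs at ht <;> omega)
        · exact h1 s t hst (by split_ifs at ht <;> omega)
    · intro s t his hst ht
      rcases Fin.eq_self_or_eq_succAbove j s with hsj | ⟨s, rfl⟩ <;>
        rcases Fin.eq_self_or_eq_succAbove j t with htj | ⟨t, rfl⟩
      · exact absurd hst (by rw [hsj, htj]; exact lt_irrefl _)
      · rw [hsj, hs, ha]; exact Fin.succ_pos _
      · rw [htj] at hst ht
        rw [Fin.lt_def] at hst
        omega
      · rw [ha, ha, Fin.succ_lt_succ_iff]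
        rw [hv] at ht his
        rw [Fin.succAbove_lt_succAbove_iff] at hst
        rcases h with ⟨h, hj, -, h2, -⟩ | ⟨h, hj, -, h2, -⟩
        · exact h2 s t (by split_ifs at his <;> omega) hst (by split_ifs at ht <;> omega)
        · exact h2 s t (by split_ifs at his <;> omega) hst (by split_ifs at ht <;> omega)
    · intro t ht
      rcases Fin.eq_self_or_eq_succAbove j t with rfl | ⟨t, rfl⟩
      · omega
      · rw [ha, Fin.ext_iff, hv, Fin.val_succ]
        rw [hv] at ht
        rcases h with ⟨h, hj, -, -, h3⟩ | ⟨h, hj, -, -, h3⟩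
        · rw [h3 t (by split_ifs at ht <;> omega)]
          split_ifs <;> omega
        · rw [h3 t (by split_ifs at ht <;> omega)]
          split_ifs at ht ⊢ <;> omega

theorem shuffles_zero_zero (N : ℕ) : shuffles N 0 0 = {1} := by
  ext σ
  rw [mem_shuffles, Finset.mem_singleton]
  constructor
  · rintro ⟨-, -, h⟩
    exact Equiv.ext fun t => h t (by simp)
  · rintro rfl
    exact ⟨fun _ _ h _ => h, fun _ _ _ h _ => h, fun _ _ => rfl⟩

variable {k V W : Type*} [Field k] [AddCommGroup W] [Module k W]

/-- The signed sum of the values of `Ψ` at the shuffles of a sequence. -/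
def shuffleSum (k : Type*) {V W : Type*} [Field k] [AddCommGroup W] [Module k W] (N i q : ℕ)
    (Ψ : (Fin N → V) → W) (X : Fin N → V) : W :=
  ∑ σ ∈ shuffles N i q, ((Equiv.Perm.sign σ : ℤ) : k) • Ψ fun t => X (σ t)

theorem shuffleSum_zero_zero (N : ℕ) (Ψ : (Fin N → V) → W) (X : Fin N → V) :
    shuffleSum k N 0 0 Ψ X = Ψ X := by
  simp [shuffleSum, shuffles_zero_zero]

theorem permCons_comp {N : ℕ} (j : Fin (N + 1)) (τ : Equiv.Perm (Fin N)) (X : Fin (N + 1) → V) :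
    (fun t => X (permCons j τ t)) =
      j.insertNth (α := fun _ => V) (X 0) fun t => X (τ t).succ := by
  funext t
  rcases Fin.eq_self_or_eq_succAbove j t with rfl | ⟨t, rfl⟩
  · simp [permCons_self]
  · simp [permCons_succAbove]

/-- This is the shuffle counterpart of the recursion of `seqComp`: the sum splits according to the
block that the first entry opens, with sign (-1)^i when it is moved past the first block. -/
theorem shuffleSum_succ {N i q : ℕ} (h0 : 0 < i + q) (hN : i + q ≤ N)
    (Ψ : (Fin (N + 1) → V) → W) (X : Fin (N + 1) → V) :
    shuffleSum k (N + 1) i q Ψ X =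
      (if 0 < i then
        shuffleSum k N (i - 1) q (fun Y => Ψ (Fin.cons (X 0) Y)) fun t => X t.succ else 0) +
      (if 0 < q then (-1 : k) ^ i • shuffleSum k N i (q - 1)
        (fun Y => Ψ ((⟨i, by omega⟩ : Fin (N + 1)).insertNth (α := fun _ => V) (X 0) Y))
          fun t => X t.succ else 0) := by
  classical
  have h1 : shuffleSum k (N + 1) i q Ψ X = ∑ j : Fin (N + 1), ∑ τ : Equiv.Perm (Fin N),
      if permCons j τ ∈ shuffles (N + 1) i q then
        ((-1 : k) ^ (j : ℕ) * ((Equiv.Perm.sign τ : ℤ) : k)) •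
          Ψ (j.insertNth (α := fun _ => V) (X 0) fun t => X (τ t).succ) else 0 := by
    have h : shuffleSum k (N + 1) i q Ψ X = ∑ σ, if σ ∈ shuffles (N + 1) i q then
        ((Equiv.Perm.sign σ : ℤ) : k) • Ψ fun t => X (σ t) else 0 := by
      simp [shuffleSum, Finset.sum_ite_mem]
    rw [h, ← Fintype.sum_prod_type', ← (permCons_bijective N).sum_comp]
    refine Finset.sum_congr rfl fun x _ => ?_
    simp only [permCons_comp, sign_permCons]
    push_cast
    rfl
  rw [h1]
  simp only [permCons_mem_shuffles h0 hN]
  -- The two alternatives exclude each other, since the first requires i > 0 and then 0 ≠ i; a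
  -- disjunction thus becomes a sum of two indicators.
  have h2 : ∀ (j : Fin (N + 1)) (τ : Equiv.Perm (Fin N)) (w : W),
      (if (0 < i ∧ (j : ℕ) = 0 ∧ τ ∈ shuffles N (i - 1) q) ∨
        (0 < q ∧ (j : ℕ) = i ∧ τ ∈ shuffles N i (q - 1)) then w else 0) =
      (if j = 0 then (if τ ∈ shuffles N (i - 1) q then (if 0 < i then w else 0) else 0) else 0) +
      (if j = ⟨i, by omega⟩ then
        (if τ ∈ shuffles N i (q - 1) then (if 0 < q then w else 0) else 0) else 0) := by
    intro j τ w
    simp only [Fin.ext_iff, Fin.val_zero]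
    split_ifs <;> grind
  simp only [h2, Finset.sum_add_distrib]
  congr 1
  · rw [Finset.sum_comm]
    simp only [Finset.sum_ite_eq', Finset.mem_univ, if_true]
    by_cases hi : 0 < i
    · simp [hi, shuffleSum, Finset.sum_ite_mem]
    · simp [hi]
  · rw [Finset.sum_comm]
    simp only [Finset.sum_ite_eq', Finset.mem_univ, if_true]
    by_cases hq : 0 < q
    · simp [hq, shuffleSum, Finset.sum_ite_mem, Finset.smul_sum, smul_smul]
    · simp [hq]

end Shuffles

/-! ### Insertion sums of multilinear maps as compositions of functions of sequences -/

section Bridge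

variable {k V : Type*} [Field k] [AddCommGroup V] [Module k V]

/-- A multilinear map of `n` arguments as a function of sequences. -/
def onSeq {n : ℕ} (F : MultilinearMap k (fun _ : Fin n => V) V) : (ℕ → V) → V :=
  fun X => F fun j => X j

theorem contract_onSeq {n : ℕ} (F : MultilinearMap k (fun _ : Fin (n + 1) => V) V) (x : V) :
    contract x (onSeq F) = onSeq (F.curryLeft x) := by
  funext X
  simp only [contract, onSeq, MultilinearMap.curryLeft_apply]
  congr 1
  funext j
  refine Fin.cases ?_ (fun j => ?_) j <;> rfl

theorem seqMultilinear_onSeq {n : ℕ} (F : MultilinearMap k (fun _ : Fin n => V) V) :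
    SeqMultilinear k n (onSeq F) := by
  induction n with
  | zero => trivial
  | succ n ih =>
    refine ⟨fun c u v => ?_, fun x => ?_⟩
    · simp only [contract_onSeq, map_add, map_smul]
      rfl
    · rw [contract_onSeq]
      exact ih _

theorem insertArgs_cons {p q r : ℕ} (h : p + q = r) (h' : p + 1 + q = r + 1) (i : Fin (p + 1))
    (G : MultilinearMap k (fun _ : Fin (q + 1) => V) V) (x : V) (Y : Fin (r + 1) → V) :
    insertArgs h' i.succ 1 G (Fin.cons x Y) =
      (Fin.cons x (insertArgs h i 1 G Y) : Fin (p + 1 + 1) → V) := by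
  have e : ∀ (n : ℕ) (hn : n + 1 < r + 1 + 1),
      (Fin.cons x Y : Fin (r + 1 + 1) → V) ⟨n + 1, hn⟩ = Y ⟨n, by omega⟩ := fun _ _ => rfl
  funext l
  refine Fin.cases ?_ (fun l => ?_) l
  · simp [insertArgs]
  · simp only [insertArgs, Equiv.Perm.one_apply, Fin.cons_succ, Fin.succ_lt_succ_iff,
      Fin.succ_inj, Fin.val_succ, e]
    split_ifs
    · rfl
    · congr 1
      funext j
      have : (⟨(i : ℕ) + 1 + j, by omega⟩ : Fin (r + 1 + 1)) = ⟨i + j + 1, by omega⟩ :=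
        Fin.ext (by simp only; omega)
      rw [this, e]
    · have : (⟨(l : ℕ) + 1 + q, by omega⟩ : Fin (r + 1 + 1)) = ⟨l + q + 1, by omega⟩ :=
        Fin.ext (by simp only; omega)
      rw [this, e]

theorem insertArgs_insertNth {p q r : ℕ} (h : p + q = r) (h' : p + (q + 1) = r + 1)
    (i : Fin (p + 1)) (G : MultilinearMap k (fun _ : Fin (q + 1 + 1) => V) V) (x : V)
    (Y : Fin (r + 1) → V) :
    insertArgs h' i 1 G
      ((⟨i, by omega⟩ : Fin (r + 1 + 1)).insertNth (α := fun _ => V) x Y) =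
      insertArgs h i 1 (G.curryLeft x) Y := by
  set Z := (⟨i, by omega⟩ : Fin (r + 1 + 1)).insertNth (α := fun _ => V) x Y with hZ
  have e0 : Z ⟨i, by omega⟩ = x := by rw [hZ, Fin.insertNth_apply_same]
  have e : ∀ t : Fin (r + 1), ∀ s : Fin (r + 1 + 1),
      (s : ℕ) = (if (t : ℕ) < i then (t : ℕ) else t + 1) → Z s = Y t := by
    intro t s hs
    have : s = (⟨i, by omega⟩ : Fin (r + 1 + 1)).succAbove t := by
      rw [Fin.ext_iff, val_succAbove, hs]
    rw [this, hZ, Fin.insertNth_apply_succAbove]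
  funext l
  simp only [insertArgs, Equiv.Perm.one_apply]
  split_ifs with h1 h2
  · rw [Fin.lt_def] at h1
    exact e _ _ (by simp only; rw [if_pos h1])
  · rw [MultilinearMap.curryLeft_apply]
    congr 1
    funext j
    refine Fin.cases ?_ (fun j => ?_) j
    · exact e0
    · refine e _ _ ?_
      simp only [Fin.val_succ]
      rw [if_neg (by omega)]
      omega
  · rw [Fin.lt_def] at h1
    refine e _ _ ?_
    simp only
    rw [if_neg (by omega)]
    omega

/-- Both sides satisfy the same recursion in the first argument: `shuffleSum_succ` on the left,
`contract_seqComp` on the right. -/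
theorem sum_shuffleSum_insertArgs {p q r : ℕ} (h : p + q = r)
    (F : MultilinearMap k (fun _ : Fin (p + 1) => V) V)
    (G : MultilinearMap k (fun _ : Fin (q + 1) => V) V) (X : ℕ → V) :
    ∑ i : Fin (p + 1), (-1 : k) ^ ((i : ℕ) * q) •
      shuffleSum k (r + 1) i q (fun Y => F (insertArgs h i 1 G Y)) (fun j => X j) =
    seqComp k (p + 1) (q + 1) (onSeq F) (onSeq G) X := by
  -- For i = q = 0 both shuffle blocks are empty and `shuffleSum_succ` does not apply: the first
  -- entry is the sole argument of G.
  have hbase : ∀ {p r : ℕ} (h : p + 0 = r) (F : MultilinearMap k (fun _ : Fin (p + 1) => V) V)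
      (G : MultilinearMap k (fun _ : Fin 1 => V) V) (X : ℕ → V),
      shuffleSum k (r + 1) 0 0 (fun Y => F (insertArgs h 0 1 G Y)) (fun j => X j) =
        seqComp k (p + 1) 0 (onSeq F) (contract (X 0) (onSeq G)) fun j => X (j + 1) := by
    intro p r h F G X
    rw [shuffleSum_zero_zero, seqComp_zero_right]
    simp only [contract, onSeq]
    congr 1
    funext l
    refine Fin.cases ?_ (fun l => ?_) l
    · simp only [insertArgs, lt_irrefl, if_false, if_true]
      simp only [Fin.val_zero, seqCons, Equiv.Perm.one_apply]
      congr 1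
      funext j
      rw [show j = 0 from Fin.fin_one_eq_zero j]
      rfl
    · simp [insertArgs, Fin.succ_ne_zero, seqCons]
  induction r generalizing p q X with
  | zero =>
    obtain rfl : p = 0 := by omega
    obtain rfl : q = 0 := by omega
    rw [Fin.sum_univ_succ, Fin.sum_univ_zero, add_zero, Fin.val_zero, hbase, zero_mul, pow_zero,
      one_smul]
    conv_rhs => rw [← seqCons_head_tail X]
    change _ = contract (X 0) _ _
    rw [contract_seqComp, seqComp_zero_succ]
    simp
  | succ r ih =>
    have hX : (fun t : Fin (r + 1) => (fun j : Fin (r + 1 + 1) => X j) t.succ) =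
      fun t : Fin (r + 1) => X (t + 1) := rfl
    conv_rhs => rw [← seqCons_head_tail X]
    change _ = contract (X 0) _ _
    rw [contract_seqComp, Fin.sum_univ_succ]
    -- The terms in which the first entry goes to F exist only for boxes i + 1, and (-1)^{(i+1)q}
    -- splits off the factor (-1)^q.
    have hA : ∀ (F : MultilinearMap k (fun _ : Fin (p + 1) => V) V),
        (∑ i : Fin p, (-1 : k) ^ (((i.succ : Fin (p + 1)) : ℕ) * q) •
          shuffleSum k (r + 1) (i : ℕ) q (fun Y => F (insertArgs h i.succ 1 G (Fin.cons (X 0) Y)))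
            (fun t => X (t + 1))) =
        (-1 : k) ^ q • seqComp k p (q + 1) (contract (X 0) (onSeq F)) (onSeq G)
          (fun j => X (j + 1)) := by
      intro F
      cases p with
      | zero => simp [seqComp_zero_succ]
      | succ p =>
        have h' : p + q = r := by omega
        rw [contract_onSeq, ← ih h' _ _ fun j => X (j + 1), Finset.smul_sum]
        refine Finset.sum_congr rfl fun i _ => ?_
        rw [smul_smul, ← pow_add, Fin.val_succ, add_mul, one_mul, add_comm q]
        simp only [insertArgs_cons h', MultilinearMap.curryLeft_apply]
    rw [Pi.add_apply, Pi.smul_apply, ← hA F]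
    cases q with
    | zero =>
      rw [add_comm]
      congr 1
      · refine Finset.sum_congr rfl fun i _ => ?_
        rw [shuffleSum_succ (by simp) (by simp; omega), if_pos (by simp), if_neg (by simp), add_zero]
        rfl
      · rw [Fin.val_zero, hbase]
        simp
    | succ q =>
      have h' : p + q = r := by omega
      -- When the first entry goes to G, the shuffle sign (-1)^i turns (-1)^{i(q+1)} into (-1)^{iq},
      -- the sign for a map with one argument fewer.
      have hB : ∀ i : Fin (p + 1), (-1 : k) ^ ((i : ℕ) * (q + 1)) •
          shuffleSum k (r + 1 + 1) i (q + 1) (fun Y => F (insertArgs h i 1 G Y)) (fun j => X j) =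
          (if 0 < (i : ℕ) then (-1 : k) ^ ((i : ℕ) * (q + 1)) •
            shuffleSum k (r + 1) (i - 1) (q + 1) (fun Y => F (insertArgs h i 1 G (Fin.cons (X 0) Y)))
              (fun t => X (t + 1)) else 0) +
          (-1 : k) ^ ((i : ℕ) * q) • shuffleSum k (r + 1) i q
            (fun Y => F (insertArgs h' i 1 (G.curryLeft (X 0)) Y)) (fun t => X (t + 1)) := by
        intro i
        rw [shuffleSum_succ (by omega) (by omega), if_pos (Nat.succ_pos q), smul_add, smul_smul,
          ← pow_add, show (i : ℕ) * (q + 1) + i = i * q + 2 * i by ring, pow_add (-1 : k) _ (2 * i),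
          pow_mul (-1 : k) 2]
        simp only [even_two, Even.neg_pow, one_pow, mul_one, smul_ite, smul_zero]
        congr 2
        simp only [← insertArgs_insertNth h' h]
        rfl
      rw [← Fin.sum_univ_succ (fun i : Fin (p + 1) => (-1 : k) ^ ((i : ℕ) * (q + 1)) •
          shuffleSum k (r + 1 + 1) i (q + 1) (fun Y => F (insertArgs h i 1 G Y)) (fun j => X j))]
      simp only [hB, Finset.sum_add_distrib]
      rw [contract_onSeq, ← ih h' _ _ fun j => X (j + 1)]
      congr 1
      rw [Fin.sum_univ_succ]
      simp

end Bridge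

/-! ### Cochains as multilinear maps on the doubled space -/

section Double

variable {p q r : ℕ} {k a : Type*} [Field k] [AddCommGroup a] [Module k a]

/-- The multilinear map on `a × a = a ⊕ ε a`, `ε² = 0`, whose value is `∑_c f ([c]; x)` without `ε`
and `ε f ([c]; x)` when the `c`-th argument carries `ε`. -/
def double {n : ℕ} (f : Cochain k a a n) : MultilinearMap k (fun _ : Fin n => a × a) (a × a) :=
  MultilinearMap.prod
    (∑ c : Fin n, (f (Finsupp.single c 1)).compLinearMap fun _ => LinearMap.fst k a a)
    (∑ c : Fin n, (f (Finsupp.single c 1)).compLinearMap fun j =>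
      if j = c then LinearMap.snd k a a else LinearMap.fst k a a)

theorem double_apply {n : ℕ} (f : Cochain k a a n) (X : Fin n → a × a) :
    double f X = (∑ c, f (Finsupp.single c 1) fun j => (X j).1,
      ∑ c, f (Finsupp.single c 1) fun j => if j = c then (X j).2 else (X j).1) := by
  simp only [double, MultilinearMap.prod_apply, _root_.sum_apply,
    MultilinearMap.compLinearMap_apply, LinearMap.fst_apply]
  congr 1
  refine Finset.sum_congr rfl fun c _ => ?_
  congr 1
  funext j
  split_ifs <;> rfl

/-- `double` is linear. -/
def doubleₗ (k a : Type*) [Field k] [AddCommGroup a] [Module k a] (n : ℕ) :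
    Cochain k a a n →ₗ[k] MultilinearMap k (fun _ : Fin n => a × a) (a × a) where
  toFun := double
  map_add' f g := MultilinearMap.ext fun X => by
    simp [double_apply, Finset.sum_add_distrib]
  map_smul' c f := MultilinearMap.ext fun X => by
    simp [double_apply, Finset.smul_sum]

/-- Evaluating with a pure ε-argument at place c and no ε elsewhere isolates f([c]; x) in the
ε-part: every other summand has a zero argument. -/
theorem double_injective {n : ℕ} : Function.Injective (doubleₗ k a n) := by
  rw [injective_iff_map_eq_zero]
  intro f hf
  ext c x
  have h : (double f fun j => if j = c then (0, x j) else (x j, 0)).2 = 0 := by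
    have := congrArg (fun F => (F fun j => if j = c then (0, x j) else (x j, 0)).2) hf
    exact this
  rw [double_apply] at h
  simp only at h
  rw [Finset.sum_eq_single c] at h
  · simp only [LinearMap.comp_apply, Finsupp.lsingle_apply, LinearMap.zero_apply]
    refine Eq.trans ?_ h
    congr 1
    funext j
    by_cases hj : j = c <;> simp [hj]
  · intro b _ hb
    exact MultilinearMap.map_coord_zero _ b (by simp [hb])
  · simp

theorem box_eq_self (h : p + q = r) (i : Fin (p + 1)) (t : Fin (r + 1))
    (ht : (i : ℕ) ≤ t ∧ (t : ℕ) ≤ i + q) : box h i t = i := by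
  rw [box, dif_neg (by omega), if_pos (by omega)]

/-- A sum over all places, box by box. -/
theorem sum_eq_sum_boxes {W : Type*} [AddCommMonoid W] (h : p + q = r) (i : Fin (p + 1))
    (K : Fin (r + 1) → W) :
    ∑ t, K t = ∑ l : Fin (p + 1), if l < i then K ⟨l, by omega⟩
      else if l = i then ∑ j : Fin (q + 1), K ⟨i + j, by omega⟩ else K ⟨l + q, by omega⟩ := by
  rw [← Finset.sum_fiberwise Finset.univ (box h i)]
  refine Finset.sum_congr rfl fun l _ => ?_
  have hb : ∀ t, box h i t = l ↔ (l : ℕ) = if (t : ℕ) < i then (t : ℕ) else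
      if (t : ℕ) ≤ i + q then (i : ℕ) else t - q := by
    intro t
    rw [Fin.ext_iff, box]
    split_ifs <;> exact eq_comm
  have hl := l.2
  split_ifs with h1 h2
  · rw [Fin.lt_def] at h1
    rw [Finset.sum_eq_single ⟨l, by omega⟩]
    · intro t ht htl
      rw [Finset.mem_filter, hb] at ht
      have := ht.2
      exact absurd (Fin.ext (by simp only; split_ifs at this <;> omega)) htl
    · intro ht
      exact absurd (by rw [Finset.mem_filter, hb]; exact ⟨Finset.mem_univ _, by simp [h1]⟩) ht
  · subst h2
    symm
    refine Finset.sum_bij (fun (j : Fin (q + 1)) _ => (⟨l + j, by omega⟩ : Fin (r + 1))) ?_ ?_ ?_ ?_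
    · intro j _
      rw [Finset.mem_filter, hb]
      refine ⟨Finset.mem_univ _, ?_⟩
      simp only
      rw [if_neg (by omega), if_pos (by omega)]
    · intro j _ j' _ e
      exact Fin.ext (by simpa using e)
    · intro t ht
      rw [Finset.mem_filter, hb] at ht
      have := ht.2
      refine ⟨⟨t - l, by split_ifs at this <;> omega⟩, Finset.mem_univ _, Fin.ext ?_⟩
      simp only
      split_ifs at this <;> omega
    · intros; rfl
  · rw [Fin.lt_def] at h1
    rw [Fin.ext_iff] at h2
    rw [Finset.sum_eq_single ⟨l + q, by omega⟩]
    · intro t ht htl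
      rw [Finset.mem_filter, hb] at ht
      have := ht.2
      exact absurd (Fin.ext (by simp only; split_ifs at this <;> omega)) htl
    · intro ht
      refine absurd ?_ ht
      rw [Finset.mem_filter, hb]
      refine ⟨Finset.mem_univ _, ?_⟩
      simp only
      rw [if_neg (by omega), if_neg (by omega)]
      omega

theorem map_sum_single {n : ℕ} {W : Type*} [AddCommGroup W] [Module k W]
    (g : (Fin n →₀ k) →ₗ[k] W) :
    g (∑ j, Finsupp.single j 1) = ∑ j, g (Finsupp.single j 1) := map_sum _ _ _

/-- The sum over all elements of the values of an insertion, box by box. -/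
theorem sum_insertion (h : p + q = r) (i : Fin (p + 1)) (σ : Equiv.Perm (Fin (r + 1)))
    (f : Cochain k a a (p + 1)) (g : Cochain k a a (q + 1))
    (x : Fin (r + 1) → Fin (r + 1) → a) :
    ∑ c, f (Finsupp.single (R h i σ c) 1) (insertArgs h i σ (g (S k h i σ c)) (x c)) =
    ∑ l : Fin (p + 1), if l < i then
        f (Finsupp.single l 1)
          (insertArgs h i σ (∑ j, g (Finsupp.single j 1)) (x (σ ⟨l, by omega⟩)))
      else if l = i then ∑ j : Fin (q + 1),
        f (Finsupp.single l 1)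
          (insertArgs h i σ (g (Finsupp.single j 1)) (x (σ ⟨i + j, by omega⟩)))
      else f (Finsupp.single l 1)
        (insertArgs h i σ (∑ j, g (Finsupp.single j 1)) (x (σ ⟨l + q, by omega⟩))) := by
  rw [← Equiv.sum_comp σ, sum_eq_sum_boxes h i]
  refine Finset.sum_congr rfl fun l _ => ?_
  simp only [R, S, Equiv.symm_apply_apply]
  split_ifs with h1 h2 h3 h4
  · rw [Fin.lt_def] at h1
    omega
  · rw [map_sum_single]
    congr 3
    rw [Fin.lt_def] at h1
    rw [box, dif_pos (by simpa using h1)]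
  · refine Finset.sum_congr rfl fun j _ => ?_
    rw [dif_pos (by simp; omega), box_eq_self h i _ (by simp; omega), h3]
    congr 4
    simp
  · rw [Fin.lt_def] at h1
    rw [Fin.ext_iff] at h3
    omega
  · rw [map_sum_single]
    congr 3
    rw [Fin.lt_def] at h1
    rw [Fin.ext_iff] at h3
    rw [box, dif_neg (by simp; omega), if_neg (by simp; omega)]
    simp

/-- This is the chain rule behind `R` and `S`. Grouping the elements c by boxes, a box other than i
contributes one term, with the full sum of g([j]) inserted; box i contributes one term for each j,
and multilinearity of f collects them into a single insertion. -/
theorem double_insertion (h : p + q = r) (i : Fin (p + 1)) (σ : Equiv.Perm (Fin (r + 1)))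
    (f : Cochain k a a (p + 1)) (g : Cochain k a a (q + 1)) (X : Fin (r + 1) → a × a) :
    double f (insertArgs h i σ (double g) X) =
      (∑ c, f (Finsupp.single (R h i σ c) 1)
          (insertArgs h i σ (g (S k h i σ c)) fun j => (X j).1),
        ∑ c, f (Finsupp.single (R h i σ c) 1)
          (insertArgs h i σ (g (S k h i σ c)) fun j => if j = c then (X j).2 else (X j).1)) := by
  have hσ : ∀ (s t : ℕ) (hs : s < r + 1) (ht : t < r + 1),
      σ ⟨s, hs⟩ = σ ⟨t, ht⟩ ↔ s = t := fun s t hs ht => by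
    rw [σ.injective.eq_iff, Fin.mk.injEq]
  have hsum : ∀ (l : Fin (p + 1)) (v : Fin (q + 1) → a) (b : Fin (p + 1) → a),
      f (Finsupp.single l 1) (Function.update b i (∑ j, v j)) =
        ∑ j, f (Finsupp.single l 1) (Function.update b i (v j)) :=
    fun l v b => MultilinearMap.map_update_sum _ _ _ _ _
  rw [double_apply, sum_insertion h i σ f g (fun _ => fun j => (X j).1),
    sum_insertion h i σ f g (fun c => fun j => if j = c then (X j).2 else (X j).1)]
  congr 1
  · refine Finset.sum_congr rfl fun l _ => ?_
    have e : (fun j => (insertArgs h i σ (double g) X j).1) =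
        insertArgs h i σ (∑ j, g (Finsupp.single j 1)) fun j => (X j).1 := by
      funext j
      unfold insertArgs
      split_ifs
      · rfl
      · simp [double_apply]
      · rfl
    rw [e]
    split_ifs with h1 h2
    · rfl
    · rw [insertArgs_eq, _root_.sum_apply, hsum]
      refine Finset.sum_congr rfl fun j _ => ?_
      rw [insertArgs_eq h i σ (g (Finsupp.single j 1))]
    · rfl
  · refine Finset.sum_congr rfl fun l _ => ?_
    have hl := l.2
    split_ifs with h1 h2
    · rw [Fin.lt_def] at h1
      congr 1
      funext j
      have hj := j.2
      unfold insertArgs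
      by_cases h3 : j < i
      · simp only [if_pos h3, hσ, Fin.ext_iff]
      · by_cases h4 : j = i
        · subst h4
          simp only [lt_irrefl, if_false, if_true, hσ, double_apply, _root_.sum_apply]
          rw [if_neg (by rw [Fin.ext_iff]; omega)]
          refine Finset.sum_congr rfl fun c _ => ?_
          congr 1
          funext s
          rw [if_neg (by omega)]
        · rw [Fin.lt_def] at h3
          simp only [Fin.lt_def, if_neg h3, if_neg h4, hσ]
          rw [if_neg (by rw [Fin.ext_iff]; omega), if_neg (by omega)]
    · subst h2
      -- With ε at place j of box l, only the inserted value of g sees it; the arguments outside the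
      -- box are the same for all j, so the sum over j can be moved inside f.
      have e : ∀ j : Fin (q + 1),
          insertArgs h l σ (g (Finsupp.single j 1)) (fun t =>
            if t = σ ⟨l + j, by omega⟩ then (X t).2 else (X t).1) =
          Function.update (insertArgs h l σ (0 : MultilinearMap k (fun _ : Fin (q + 1) => a) a)
            fun t => (X t).1) l (g (Finsupp.single j 1) fun s =>
              if s = j then (X (σ ⟨l + s, by omega⟩)).2 else (X (σ ⟨l + s, by omega⟩)).1) := by
        intro j
        rw [insertArgs_eq]
        simp only [hσ]
        have e2 : insertArgs h l σ (0 : MultilinearMap k (fun _ : Fin (q + 1) => a) a) (fun t =>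
            if t = σ ⟨l + j, by omega⟩ then (X t).2 else (X t).1) =
            insertArgs h l σ (0 : MultilinearMap k (fun _ : Fin (q + 1) => a) a)
              fun t => (X t).1 := by
          funext s
          unfold insertArgs
          split_ifs with h3 h4
          · rw [Fin.lt_def] at h3
            exact if_neg (by rw [hσ]; omega)
          · rfl
          · rw [Fin.lt_def] at h3
            rw [Fin.ext_iff] at h4
            exact if_neg (by rw [hσ]; omega)
        rw [e2]
        congr 2
        funext s
        simp only [Fin.ext_iff, add_right_inj]
      simp only [e]
      rw [← hsum]
      congr 1
      funext j
      by_cases hj : j = l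
      · subst hj
        simp [insertArgs, double_apply]
      · rw [Function.update_of_ne hj, if_neg hj]
        simp only [insertArgs, if_neg hj]
        split_ifs <;> rfl
    · rw [Fin.lt_def] at h1
      rw [Fin.ext_iff] at h2
      congr 1
      funext j
      have hj := j.2
      unfold insertArgs
      by_cases h3 : j < i
      · rw [Fin.lt_def] at h3
        simp only [Fin.lt_def, if_pos h3, hσ, Fin.ext_iff]
        rw [if_neg (by omega), if_neg (by omega)]
      · by_cases h4 : j = i
        · subst h4
          simp only [lt_irrefl, if_false, if_true, hσ, double_apply, _root_.sum_apply]
          rw [if_neg (by rw [Fin.ext_iff]; omega)]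
          refine Finset.sum_congr rfl fun c _ => ?_
          congr 1
          funext s
          rw [if_neg (by omega)]
        · rw [Fin.lt_def] at h3
          simp only [Fin.lt_def, if_neg h3, if_neg h4, hσ, add_left_inj]
          simp only [Fin.ext_iff]

theorem double_diamond (h : p + q = r) (i : Fin (p + 1)) (f : Cochain k a a (p + 1))
    (g : Cochain k a a (q + 1)) (X : Fin (r + 1) → a × a) :
    double (diamond h i f g) X = shuffleSum k (r + 1) i q
      (fun Y => double f (insertArgs h i 1 (double g) Y)) X := by
  have e : ∀ σ : Equiv.Perm (Fin (r + 1)), insertArgs h i 1 (double g) (fun t => X (σ t)) =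
    insertArgs h i σ (double g) X := fun _ => rfl
  simp only [shuffleSum, e, double_insertion]
  rw [double_apply]
  simp only [diamond, Finsupp.linearCombination_single, one_smul, _root_.sum_apply,
    _root_.smul_apply, insertionₗ, LinearMap.mk₂_apply, insertion_apply]
  ext
  · simp only [Prod.fst_sum, Prod.smul_fst, Finset.smul_sum]
    exact Finset.sum_comm
  · simp only [Prod.snd_sum, Prod.smul_snd, Finset.smul_sum]
    exact Finset.sum_comm

/-- The sum `∑_i (-1)^{i q} f ⋄_i g` over all boxes. -/
def preLieProd (k a : Type*) [Field k] [AddCommGroup a] [Module k a] :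
    GradedBilin k (fun p => Cochain k a a (p + 1)) := fun p q _ h =>
  ∑ i : Fin (p + 1), (-1 : k) ^ ((i : ℕ) * q) • diamondₗ k a h i

theorem onSeq_double_preLieProd (h : p + q = r) (f : Cochain k a a (p + 1))
    (g : Cochain k a a (q + 1)) :
    onSeq (double (preLieProd k a p q r h f g)) =
      seqComp k (p + 1) (q + 1) (onSeq (double f)) (onSeq (double g)) := by
  funext X
  rw [← sum_shuffleSum_insertArgs h]
  have e : double (preLieProd k a p q r h f g) =
      ∑ i : Fin (p + 1), (-1 : k) ^ ((i : ℕ) * q) • double (diamond h i f g) := by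
    change doubleₗ k a _ _ = ∑ i : Fin (p + 1), (-1 : k) ^ ((i : ℕ) * q) • doubleₗ k a _ _
    simp only [preLieProd, LinearMap.sum_apply, LinearMap.smul_apply, map_sum, map_smul]
    rfl
  rw [onSeq, e, _root_.sum_apply]
  refine Finset.sum_congr rfl fun i _ => ?_
  rw [_root_.smul_apply, double_diamond]

theorem onSeq_injective {V : Type*} [AddCommGroup V] [Module k V] {n : ℕ} :
    Function.Injective (onSeq : MultilinearMap k (fun _ : Fin n => V) V → _) := by
  intro F G h
  ext x
  have := congrFun h fun j => if hj : j < n then x ⟨j, hj⟩ else 0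
  simpa [onSeq] using this

theorem cochain_ext {n : ℕ} {f g : Cochain k a a n} (h : onSeq (double f) = onSeq (double g)) :
    f = g :=
  double_injective (onSeq_injective h)

/-- The associator of `preLieProd` is graded symmetric in the last two arguments. -/
theorem preLieProd_assoc_symm (p q s pq qs ps t : ℕ) (hpq : p + q = pq) (hqs : q + s = qs)
    (hps : p + s = ps) (h₁ : p + qs = t) (h₂ : pq + s = t) (h₃ : ps + q = t) (hsq : s + q = qs)
    (f : Cochain k a a (p + 1)) (g : Cochain k a a (q + 1)) (h : Cochain k a a (s + 1)) :
    preLieProd k a pq s t h₂ (preLieProd k a p q pq hpq f g) h -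
      preLieProd k a p qs t h₁ f (preLieProd k a q s qs hqs g h) =
    (-1 : k) ^ (q * s) • (preLieProd k a ps q t h₃ (preLieProd k a p s ps hps f h) g -
      preLieProd k a p qs t h₁ f (preLieProd k a s q qs hsq h g)) := by
  have e : ∀ F G : Cochain k a a (t + 1), onSeq (double (F - G)) =
      onSeq (double F) - onSeq (double G) := by
    intro F G
    have := map_sub (doubleₗ k a (t + 1)) F G
    change double (F - G) = double F - double G at this
    rw [this]
    rfl
  have e' : ∀ (c : k) (F : Cochain k a a (t + 1)), onSeq (double (c • F)) =
      c • onSeq (double F) := by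
    intro c F
    have := map_smul (doubleₗ k a (t + 1)) c F
    change double (c • F) = c • double F at this
    rw [this]
    rfl
  apply cochain_ext
  rw [e', e, e]
  simp only [onSeq_double_preLieProd]
  -- The doubled product is `seqComp`, so both sides are associators of functions of sequences.
  have := seqAssoc_symm (p + 1) q s (onSeq (double f)) (onSeq (double g)) (onSeq (double h))
    (seqMultilinear_onSeq _)
  unfold seqAssoc at this
  subst hpq hqs hps
  rw [show p + q + 1 = p + 1 + q by omega, show p + s + 1 = p + 1 + s by omega, this,
    add_comm s q]

end Double

/-! ### The differential graded Lie algebra of cochains -/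

section GradedLie

variable {k a : Type*} [Field k] [AddCommGroup a] [Module k a]

theorem plBracket_apply (p q r : ℕ) (h : p + q = r) (h' : q + p = r) (f : Cochain k a a (p + 1))
    (g : Cochain k a a (q + 1)) :
    plBracket k a p q r h f g =
      preLieProd k a p q r h f g - (-1 : k) ^ (p * q) • preLieProd k a q p r h' g f := by
  simp [plBracket, preLieProd, LinearMap.sum_apply]

theorem neg_one_pow_mul_self (n : ℕ) : (-1 : k) ^ n * (-1) ^ n = 1 := by
  rw [← mul_pow]
  simp

/-- The bracket is the graded commutator of a graded right pre-Lie product; Jacobi is the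
combination of the three associator symmetries with f, g and h in the first place. -/
theorem isGradedLie_plBracket : IsGradedLie (plBracket k a) where
  skew p q r h h' f g := by
    rw [plBracket_apply p q r h h', plBracket_apply q p r h' h, smul_sub, smul_smul,
      mul_comm q p, neg_one_pow_mul_self]
    module
  jacobi p q s pq qs ps t hpq hqs hps h₁ h₂ h₃ f g h := by
    have hqp : q + p = pq := by omega
    have hsq : s + q = qs := by omega
    have hsp : s + p = ps := by omega
    have h₁' : qs + p = t := by omega
    have h₂' : s + pq = t := by omega
    have h₃' : ps + q = t := by omega
    have A₁ := preLieProd_assoc_symm p q s pq qs ps t hpq hqs hps h₁ h₂ h₃' hsq f g h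
    have A₂ := preLieProd_assoc_symm q p s pq ps qs t hqp hps hqs h₃ h₂ h₁' hsp g f h
    have A₃ := preLieProd_assoc_symm s p q ps pq qs t hsp hpq hsq h₂' h₃' h₁' hqp h f g
    have ea : (-1 : k) ^ (p * qs) = (-1) ^ (p * q) * (-1) ^ (p * s) := by
      rw [← hqs, mul_add, pow_add]
    have eb : (-1 : k) ^ (pq * s) = (-1) ^ (p * s) * (-1) ^ (q * s) := by
      rw [← hpq, add_mul, pow_add]
    have ec : (-1 : k) ^ (q * ps) = (-1) ^ (p * q) * (-1) ^ (q * s) := by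
      rw [← hps, mul_add, pow_add, mul_comm q p]
    rw [plBracket_apply p qs t h₁ h₁', plBracket_apply q s qs hqs hsq,
      plBracket_apply pq s t h₂ h₂', plBracket_apply p q pq hpq hqp,
      plBracket_apply q ps t h₃ h₃', plBracket_apply p s ps hps hsp, ea, eb, ec]
    simp only [map_sub, map_smul, LinearMap.sub_apply, LinearMap.smul_apply]
    have hα := neg_one_pow_mul_self (k := k) (p * q)
    have hβ := neg_one_pow_mul_self (k := k) (q * s)
    have hγ := neg_one_pow_mul_self (k := k) (p * s)
    -- All signs are products of three elements of square one, so the comparison of coefficients is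
    -- polynomial.
    generalize (-1 : k) ^ (p * q) = α at *
    generalize (-1 : k) ^ (q * s) = β at *
    generalize (-1 : k) ^ (p * s) = γ at *
    rw [sub_eq_iff_eq_add] at A₁ A₂ A₃
    rw [A₁, A₂, A₃]
    match_scalars
    all_goals try ring1
    · linear_combination -(α * β * γ) * hα
    · linear_combination β * hα
    · linear_combination -(γ * β) * hα
    · linear_combination α * β * γ * hα

/-! ### The structure cochain `π` and its square -/

theorem seqComp_two_two {V : Type*} [AddCommGroup V] [Module k V] (f g : (ℕ → V) → V)
    (X : ℕ → V) :
    seqComp k 2 2 f g X =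
      -f (seqCons (X 0) (seqCons (g (seqCons (X 1) (seqCons (X 2) 0))) fun j => X (j + 3))) +
      f (seqCons (X 1) (seqCons (g (seqCons (X 0) (seqCons (X 2) 0))) fun j => X (j + 3))) +
      f (seqCons (g (seqCons (X 0) (seqCons (X 1) 0))) fun j => X (j + 2)) := by
  simp only [seqComp, Pi.zero_apply, contract, zero_add, pow_zero, pow_one, smul_zero, one_smul,
    neg_smul]
  abel

theorem onSeq_double_π (A : PreLeibniz k a) (X : ℕ → a × a) :
    onSeq (double A.π) X =
      (A.lt (X 0).1 (X 1).1 + A.rt (X 0).1 (X 1).1,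
        A.lt (X 0).2 (X 1).1 + A.rt (X 0).1 (X 1).2) := by
  simp [onSeq, double_apply, PreLeibniz.π, Fin.sum_univ_two, bilin]

/-- On a ⊕ εa the claim is the left Leibniz identity for the product `double A.π`. Its part without
ε is the sum of the three axioms; its ε-part is one axiom for each of the three arguments that may
carry ε. -/
theorem preLieProd_π_π (A : PreLeibniz k a) :
    preLieProd k a 1 1 2 rfl A.π A.π = 0 := by
  apply cochain_ext
  rw [onSeq_double_preLieProd]
  have h0 : onSeq (double (0 : Cochain k a a 3)) = 0 := by
    have := map_zero (doubleₗ k a 3)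
    change double (0 : Cochain k a a 3) = 0 at this
    rw [this]
    rfl
  rw [h0]
  funext X
  change seqComp k 2 2 _ _ X = 0
  rw [seqComp_two_two]
  simp only [onSeq_double_π, seqCons]
  generalize X 0 = x, X 1 = y, X 2 = z
  have i1 := A.iden₁
  have i2 := A.iden₂
  have i3 := A.iden₃
  simp only [map_add, LinearMap.add_apply] at i1 i2 i3
  ext
  · simp only [map_add, LinearMap.add_apply, Prod.fst_add, Prod.fst_neg, Prod.fst_zero]
    have e1 := i1 x.1 y.1 z.1
    have e2 := i2 x.1 y.1 z.1
    have e3 := i3 x.1 y.1 z.1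
    rw [e2, e3, e1]
    abel
  · simp only [map_add, LinearMap.add_apply, Prod.snd_add, Prod.snd_neg, Prod.snd_zero]
    have e1 := i1 x.2 y.1 z.1
    have e2 := i2 x.1 y.2 z.1
    have e3 := i3 x.1 y.1 z.2
    rw [e2, e3, e1]
    abel

/-- Since π has odd degree, Jacobi for π, π, f reads [π, [π, f]] = [[π, π], f] - [π, [π, f]]. With
[π, π] = 0 this gives twice the claim, and 2 is invertible. -/
theorem dπ_dπ [CharZero k] (A : PreLeibniz k a) (p : ℕ) (f : Cochain k a a (p + 1)) :
    A.dπ (p + 1) (A.dπ p f) = 0 := by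
  have h := isGradedLie_plBracket.jacobi 1 1 p 2 (p + 1) (p + 1) (p + 1 + 1) rfl
    (Nat.add_comm 1 p) (Nat.add_comm 1 p) (Nat.add_comm 1 (p + 1)) (by omega)
    (Nat.add_comm 1 (p + 1)) A.π A.π f
  have hπ : plBracket k a 1 1 2 rfl A.π A.π = 0 := by
    rw [plBracket_apply 1 1 2 rfl rfl, preLieProd_π_π]
    simp
  rw [hπ, map_zero, LinearMap.zero_apply, zero_add, mul_one, pow_one, neg_one_smul,
    eq_neg_iff_add_eq_zero, ← two_smul k] at h
  exact (smul_eq_zero.1 h).resolve_left two_ne_zero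

theorem isDGLie_plBracket [CharZero k] (A : PreLeibniz k a) :
    IsDGLie (plBracket k a) A.dπ where
  toIsGradedLie := isGradedLie_plBracket
  d_d := dπ_dπ A
  d_br p q r h h₁ h₂ f g := by
    -- The derivation rule for ⟦π, -⟧ is Jacobi with π as first entry.
    have := isGradedLie_plBracket.jacobi 1 p q (p + 1) r (q + 1) (r + 1) (Nat.add_comm 1 p) h
      (Nat.add_comm 1 q) (Nat.add_comm 1 r) h₁ h₂ A.π f g
    rwa [one_mul] at this

end GradedLie

/-! ### The coboundary operator -/

section Coboundary

theorem perm_eq_one_of_strictMono {N : ℕ} {σ : Equiv.Perm (Fin N)} (h : StrictMono σ) : σ = 1 := by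
  have := Subsingleton.elim (h.orderIsoOfSurjective _ σ.surjective) (OrderIso.refl (Fin N))
  exact Equiv.ext fun t => by simpa using congrArg (fun e : Fin N ≃o Fin N => e t) this

/-- A shuffle is determined by the values on its first block. -/
theorem shuffle_ext {N i q : ℕ} {σ τ : Equiv.Perm (Fin N)} (hσ : σ ∈ shuffles N i q)
    (hτ : τ ∈ shuffles N i q) (h : ∀ s : Fin N, (s : ℕ) < i → (τ.symm (σ s) : ℕ) < i)
    (h' : ∀ s : Fin N, i ≤ (s : ℕ) → i ≤ (τ.symm (σ s) : ℕ)) : σ = τ := by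
  rw [mem_shuffles] at hσ hτ
  obtain ⟨a1, a2, a3⟩ := hσ
  obtain ⟨b1, b2, b3⟩ := hτ
  have hfix : ∀ s : Fin N, i + q ≤ (s : ℕ) → τ.symm (σ s) = s := fun s hs => by
    rw [a3 s hs, Equiv.symm_apply_eq, b3 s hs]
  have hlt : ∀ s : Fin N, (s : ℕ) < i + q → (τ.symm (σ s) : ℕ) < i + q := fun s hs => by
    by_contra hc
    have e := hfix _ (not_lt.1 hc)
    have : τ.symm (σ s) = s := σ.injective (τ.symm.injective e)
    rw [this] at hc
    exact hc hs
  have hinj : ∀ s t : Fin N, s < t → τ.symm (σ t) ≤ τ.symm (σ s) →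
      τ.symm (σ t) < τ.symm (σ s) := fun s t hst hle =>
    lt_of_le_of_ne hle fun e => hst.ne' (σ.injective (τ.symm.injective e))
  -- The composite preserves both blocks and is increasing on each, so it is an increasing
  -- permutation, hence the identity.
  have hm : StrictMono (τ⁻¹ * σ) := by
    intro s t hst
    change τ.symm (σ s) < τ.symm (σ t)
    have hst' := Fin.lt_def.1 hst
    by_contra hc
    have hlt' := hinj s t hst (not_lt.1 hc)
    by_cases ht : (t : ℕ) < i
    · have := b1 _ _ hlt' (h s (by omega))
      rw [Equiv.apply_symm_apply, Equiv.apply_symm_apply] at this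
      exact absurd this (a1 s t hst ht).not_gt
    · have h1 := h' t (by omega)
      by_cases ht2 : (t : ℕ) < i + q
      · by_cases hs : (s : ℕ) < i
        · have := h s hs
          rw [Fin.lt_def] at hlt'
          omega
        · have := b2 _ _ h1 hlt' (hlt s (by omega))
          rw [Equiv.apply_symm_apply, Equiv.apply_symm_apply] at this
          exact absurd this (a2 s t (by omega) hst ht2).not_gt
      · have e := hfix t (by omega)
        rw [e, Fin.lt_def] at hlt'
        by_cases hs : (s : ℕ) < i + q
        · have := hlt s hs
          omega
        · rw [hfix s (by omega)] at hlt'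
          omega
  exact (inv_mul_eq_one.1 (perm_eq_one_of_strictMono hm)).symm

theorem shuffles_zero_left (N q : ℕ) : shuffles N 0 q = {1} := by
  have h1 : (1 : Equiv.Perm (Fin N)) ∈ shuffles N 0 q :=
    mem_shuffles.2 ⟨fun _ _ h _ => h, fun _ _ _ h _ => h, fun _ _ => rfl⟩
  ext σ
  rw [Finset.mem_singleton]
  exact ⟨fun h => shuffle_ext h h1 (fun s hs => absurd hs (by omega)) fun s _ => Nat.zero_le _,
    fun h => h ▸ h1⟩

theorem frontShuffle_zero {n : ℕ} (i : Fin (n + 1)) : frontShuffle i 0 = i :=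
  Fin.cycleRange_symm_zero i

theorem frontShuffle_succ {n : ℕ} (i : Fin (n + 1)) (t : Fin n) :
    frontShuffle i t.succ = i.succAbove t :=
  Fin.cycleRange_symm_succ i t

theorem frontShuffle_mem {p : ℕ} (i : Fin (p + 1)) :
    frontShuffle i.castSucc ∈ shuffles (p + 1 + 1) 1 p := by
  rw [mem_shuffles]
  refine ⟨fun s t hst ht => ?_, fun s t hs hst ht => ?_, fun t ht => ?_⟩
  · rw [Fin.lt_def] at hst
    omega
  · obtain ⟨s, rfl⟩ := Fin.exists_succ_eq.2 (show s ≠ 0 by rintro rfl; simp at hs)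
    obtain ⟨t, rfl⟩ := Fin.exists_succ_eq.2 (show t ≠ 0 by rintro rfl; simp at hst)
    rw [frontShuffle_succ, frontShuffle_succ, Fin.succAbove_lt_succAbove_iff]
    exact Fin.succ_lt_succ_iff.1 hst
  · have : t = (Fin.last p).succ := Fin.ext (by simp; omega)
    rw [this, frontShuffle_succ, Fin.ext_iff, val_succAbove]
    simp only [Fin.val_castSucc, Fin.val_last, Fin.val_succ]
    rw [if_neg (by omega)]

/-- A shuffle in Sh(1, p) is determined by its first value, which cannot be the last element because
that one is fixed. -/
theorem sum_shuffles_one {p : ℕ} {W : Type*} [AddCommMonoid W]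
    (Φ : Equiv.Perm (Fin (p + 1 + 1)) → W) :
    ∑ σ ∈ shuffles (p + 1 + 1) 1 p, Φ σ = ∑ i : Fin (p + 1), Φ (frontShuffle i.castSucc) := by
  symm
  refine Finset.sum_bij (fun i _ => frontShuffle i.castSucc) (fun i _ => frontShuffle_mem i)
    ?_ ?_ fun _ _ => rfl
  · intro i _ j _ h
    have := congrArg (fun σ : Equiv.Perm (Fin (p + 1 + 1)) => σ 0) h
    simp only [frontShuffle_zero] at this
    exact Fin.castSucc_injective _ this
  · intro σ hσ
    have hl : σ 0 ≠ Fin.last (p + 1) := by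
      intro h
      have e := (mem_shuffles.1 hσ).2.2 (Fin.last (p + 1)) (by simp; omega)
      have := σ.injective (h.trans e.symm)
      simp [Fin.ext_iff] at this
    obtain ⟨i, hi⟩ := Fin.exists_castSucc_eq.2 hl
    have h0 : (frontShuffle i.castSucc).symm (σ 0) = 0 := by
      rw [Equiv.symm_apply_eq, frontShuffle_zero, hi]
    refine ⟨i, Finset.mem_univ _, (shuffle_ext hσ (frontShuffle_mem i) ?_ ?_).symm⟩
    · intro s hs
      rw [show s = 0 from Fin.ext (by simpa using hs), h0]
      simp
    · intro s hs
      have : (frontShuffle i.castSucc).symm (σ s) ≠ 0 := by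
        intro h
        rw [← h0] at h
        have := σ.injective ((frontShuffle i.castSucc).symm.injective h)
        rw [this] at hs
        simp at hs
      exact Nat.one_le_iff_ne_zero.2 fun h => this (Fin.ext h)

theorem val_moveShuffle {n : ℕ} {i l : Fin (n + 1)} (h : i ≤ l) (t : Fin (n + 1)) :
    (moveShuffle i l t : ℕ) = if (t : ℕ) < i then (t : ℕ) else if (t : ℕ) < l then t + 1
      else if (t : ℕ) = l then (i : ℕ) else t := by
  unfold moveShuffle
  split_ifs with h1 h2 h3
  · rw [Fin.cycleIcc_of_lt (Fin.lt_def.2 h1)]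
  · rw [Fin.cycleIcc_of_ge_of_lt (Fin.le_def.2 (not_lt.1 h1)) (Fin.lt_def.2 h2)]
    exact Fin.val_add_one_of_lt (lt_of_lt_of_le (Fin.lt_def.2 h2) (Fin.le_last _))
  · rw [show t = l from Fin.ext h3, Fin.cycleIcc_of_last h]
  · rw [Fin.cycleIcc_of_gt (Fin.lt_def.2 (by omega))]

theorem moveShuffle_mem {p : ℕ} {i l : Fin (p + 1)} (h : i ≤ l) :
    moveShuffle i.castSucc l.castSucc ∈ shuffles (p + 1 + 1) l 1 := by
  have hv := val_moveShuffle (Fin.castSucc_le_castSucc_iff.2 h)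
  simp only [Fin.val_castSucc] at hv
  rw [Fin.le_def] at h
  rw [mem_shuffles]
  refine ⟨fun s t hst ht => ?_, fun s t hs hst ht => ?_, fun t ht => ?_⟩
  · rw [Fin.lt_def] at hst ⊢
    rw [hv, hv]
    split_ifs <;> omega
  · rw [Fin.lt_def] at hst
    omega
  · rw [Fin.ext_iff, hv]
    split_ifs <;> omega

theorem moveShuffle_last {n : ℕ} {i l : Fin (n + 1)} (h : i ≤ l) : moveShuffle i l l = i :=
  Fin.cycleIcc_of_last h

/-- A shuffle in Sh(l, 1) is determined by its value at place l, which is at most l because all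
later places are fixed. -/
theorem sum_shuffles_move {p : ℕ} (l : Fin (p + 1)) {W : Type*} [AddCommMonoid W]
    (Φ : Equiv.Perm (Fin (p + 1 + 1)) → W) :
    ∑ σ ∈ shuffles (p + 1 + 1) l 1, Φ σ =
      ∑ i ∈ Finset.Iic l, Φ (moveShuffle i.castSucc l.castSucc) := by
  have hle : ∀ i : Fin (p + 1), i ∈ Finset.Iic l → i.castSucc ≤ l.castSucc := fun i hi =>
    Fin.castSucc_le_castSucc_iff.2 (Finset.mem_Iic.1 hi)
  symm
  refine Finset.sum_bij (fun i _ => moveShuffle i.castSucc l.castSucc)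
    (fun i hi => moveShuffle_mem (Finset.mem_Iic.1 hi)) ?_ ?_ fun _ _ => rfl
  · intro i hi j hj h
    have := congrArg (fun σ : Equiv.Perm (Fin (p + 1 + 1)) => σ l.castSucc) h
    simp only [moveShuffle_last (hle i hi), moveShuffle_last (hle j hj)] at this
    exact Fin.castSucc_injective _ this
  · intro σ hσ
    have hfix := (mem_shuffles.1 hσ).2.2
    have hl : σ l.castSucc ≤ l.castSucc := by
      by_contra h
      rw [not_le, Fin.lt_def, Fin.val_castSucc] at h
      have e := σ.injective (hfix (σ l.castSucc) (by omega))
      rw [e, Fin.val_castSucc] at h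
      omega
    have hl2 : σ l.castSucc ≠ Fin.last (p + 1) :=
      (lt_of_le_of_lt hl (Fin.castSucc_lt_last l)).ne
    obtain ⟨i, hi⟩ := Fin.exists_castSucc_eq.2 hl2
    have hil : i ≤ l := by rwa [← hi, Fin.castSucc_le_castSucc_iff] at hl
    have hmem := moveShuffle_mem hil
    have hfix' := (mem_shuffles.1 hmem).2.2
    have h0 : (moveShuffle i.castSucc l.castSucc).symm (σ l.castSucc) = l.castSucc := by
      rw [Equiv.symm_apply_eq, moveShuffle_last (Fin.castSucc_le_castSucc_iff.2 hil), hi]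
    have h2 : ∀ s : Fin (p + 1 + 1), (l : ℕ) + 1 ≤ s →
        (moveShuffle i.castSucc l.castSucc).symm (σ s) = s := fun s hs => by
      rw [Equiv.symm_apply_eq, hfix s hs, hfix' s hs]
    refine ⟨i, Finset.mem_Iic.2 hil, (shuffle_ext hσ hmem ?_ ?_).symm⟩
    · intro s hs
      by_contra hc
      rcases Nat.eq_or_lt_of_le (not_lt.1 hc) with e | e
      · have e' : (moveShuffle i.castSucc l.castSucc).symm (σ s) = l.castSucc := Fin.ext e.symm
        have := σ.injective
          ((moveShuffle i.castSucc l.castSucc).symm.injective (e'.trans h0.symm))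
        rw [this] at hs
        simp at hs
      · have := σ.injective ((moveShuffle i.castSucc l.castSucc).symm.injective (h2 _ e))
        rw [this] at e
        omega
    · intro s hs
      rcases Nat.eq_or_lt_of_le hs with e | e
      · rw [show s = l.castSucc from Fin.ext e.symm, h0]
        simp
      · rw [h2 s e]
        exact hs

/-! ### Comparison of the coboundary with `⟦π, -⟧` -/

variable {k a : Type*} [Field k] [AddCommGroup a] [Module k a]

theorem π_single_apply (A : PreLeibniz k a) (b : Fin 2) (y : Fin 2 → a) :
    A.π (Finsupp.single b 1) y = (adjoint A).πL b (y 0) (y 1) := by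
  fin_cases b <;> simp [PreLeibniz.π, Rep.πL, adjoint, bilin]

theorem diamond_single {p q r : ℕ} (h : p + q = r) (i : Fin (p + 1)) (f : Cochain k a a (p + 1))
    (g : Cochain k a a (q + 1)) (c : Fin (r + 1)) :
    diamond h i f g (Finsupp.single c 1) = ∑ σ ∈ shuffles (r + 1) i q,
      ((Equiv.Perm.sign σ : ℤ) : k) •
        insertionₗ h i σ (f (Finsupp.single (R h i σ c) 1)) (g (S k h i σ c)) := by
  rw [diamond, Finsupp.linearCombination_single, one_smul]

theorem diamond_one_π (A : PreLeibniz k a) (p : ℕ) (f : Cochain k a a (p + 1))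
    (c : Fin (p + 1 + 1)) :
    diamond (Nat.add_comm 1 p) 1 A.π f (Finsupp.single c 1) =
      ∑ i : Fin (p + 1), (-1 : k) ^ (i : ℕ) •
        leftTermₗ
          ((adjoint A).πL (R (Nat.add_comm 1 p) 1 (frontShuffle i.castSucc) c)) i.castSucc
          (f (S k (Nat.add_comm 1 p) 1 (frontShuffle i.castSucc) c)) := by
  rw [diamond_single, show ((1 : Fin (1 + 1)) : ℕ) = 1 from rfl, sum_shuffles_one]
  refine Finset.sum_congr rfl fun i _ => ?_
  congr 1
  · simp [frontShuffle]
  · ext x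
    simp only [insertionₗ, LinearMap.mk₂_apply, insertion_apply, leftTermₗ_apply]
    rw [π_single_apply]
    congr 2
    · exact congrArg x (frontShuffle_zero i.castSucc)
    · simp only [insertArgs, lt_irrefl, if_false, if_true]
      congr 1
      funext j
      rw [← frontShuffle_succ]
      congr 2
      exact Fin.ext (by simp; omega)

theorem diamond_zero_π (A : PreLeibniz k a) (p : ℕ) (f : Cochain k a a (p + 1))
    (c : Fin (p + 1 + 1)) :
    diamond (Nat.add_comm 1 p) 0 A.π f (Finsupp.single c 1) =
      rightTermₗ ((adjoint A).πR (R (Nat.add_comm 1 p) 0 1 c))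
        (f (S k (Nat.add_comm 1 p) 0 1 c)) := by
  rw [diamond_single, show ((0 : Fin (1 + 1)) : ℕ) = 0 from rfl, shuffles_zero_left,
    Finset.sum_singleton]
  simp only [Equiv.Perm.sign_one, Units.val_one, Int.cast_one, one_smul]
  ext x
  simp only [insertionₗ, LinearMap.mk₂_apply, insertion_apply, rightTermₗ_apply]
  rw [π_single_apply]
  change (adjoint A).πL _ _ _ = (adjoint A).πL _ _ _
  congr 2
  · simp only [insertArgs, lt_irrefl, if_false, if_true]
    congr 1
    funext j
    exact congrArg x (Fin.ext (by simp))
  · simp only [insertArgs]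
    exact congrArg x (Fin.ext (by simp; omega))

theorem diamond_π (A : PreLeibniz k a) (p : ℕ) (f : Cochain k a a (p + 1)) (l : Fin (p + 1))
    (c : Fin (p + 1 + 1)) :
    (-1 : k) ^ ((l : ℕ) + 1) • diamond (rfl : p + 1 = p + 1) l f A.π (Finsupp.single c 1) =
      ∑ i ∈ Finset.Iic l, (-1 : k) ^ ((i : ℕ) + 1) •
        insertionₗ (rfl : p + 1 = p + 1) l (moveShuffle i.castSucc l.castSucc)
          (f (Finsupp.single (R (rfl : p + 1 = p + 1) l (moveShuffle i.castSucc l.castSucc) c) 1))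
          (A.π (S k (rfl : p + 1 = p + 1) l (moveShuffle i.castSucc l.castSucc) c)) := by
  rw [diamond_single, sum_shuffles_move, Finset.smul_sum]
  refine Finset.sum_congr rfl fun i hi => ?_
  have hi' := Finset.mem_Iic.1 hi
  rw [smul_smul]
  congr 1
  rw [moveShuffle, Fin.sign_cycleIcc_of_le (Fin.castSucc_le_castSucc_iff.2 hi')]
  push_cast
  rw [Fin.le_def] at hi'
  simp only [Fin.val_castSucc]
  -- Moving entry i to place l is a cycle of sign (-1)^{l-i}, which turns (-1)^{l+1} into
  -- (-1)^{i+1}.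
  rw [← pow_add, show (l : ℕ) + 1 + (l - i) = 2 * (l - i) + (i + 1) by omega, pow_add, pow_mul]
  simp

/-- The three sums of the coboundary are π ⋄ f in the second place, π ⋄ f in the first place, and
all f ⋄_l π; only the signs need comparison. -/
theorem coboundary_eq (A : PreLeibniz k a) (p : ℕ) (f : Cochain k a a (p + 1)) :
    coboundary (adjoint A) p f = (-1 : k) ^ p • A.dπ p f := by
  have h1 : A.dπ p f = diamond (Nat.add_comm 1 p) 0 A.π f +
      (-1 : k) ^ p • diamond (Nat.add_comm 1 p) 1 A.π f -
      (-1 : k) ^ p • ∑ l : Fin (p + 1), (-1 : k) ^ (l : ℕ) •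
        diamond (rfl : p + 1 = p + 1) l f A.π := by
    rw [PreLeibniz.dπ, plBracket_apply 1 p (p + 1) _ rfl]
    simp [preLieProd, diamondₗ, Fin.sum_univ_two, LinearMap.sum_apply]
  refine Finsupp.lhom_ext' fun c => LinearMap.ext_ring ?_
  simp only [LinearMap.comp_apply, Finsupp.lsingle_apply]
  have h2 : coboundary (adjoint A) p f (Finsupp.single c 1) = coboundaryAux (adjoint A) p f c := by
    change Finsupp.linearCombination k (coboundaryAux (adjoint A) p f) (Finsupp.single c 1) = _
    rw [Finsupp.linearCombination_single, one_smul]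
  rw [h2, h1, coboundaryAux, ← diamond_one_π, ← diamond_zero_π]
  simp only [← diamond_π]
  simp only [LinearMap.smul_apply, LinearMap.sub_apply, LinearMap.add_apply, LinearMap.sum_apply,
    pow_succ, mul_neg_one, neg_smul, Finset.sum_neg_distrib]
  have hp := neg_one_pow_mul_self (k := k) p
  match_scalars
  · linear_combination -hp
  · ring
  · linear_combination hp

end Coboundary

/-! ### The bracket on cohomology -/

section CohomologyBracket

variable {k a : Type*} [Field k] [AddCommGroup a] [Module k a]

theorem mem_cocycles_iff (A : PreLeibniz k a) {p : ℕ} {f : Cochain k a a (p + 1)} :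
    f ∈ cocycles (adjoint A) p ↔ A.dπ p f = 0 := by
  rw [cocycles, LinearMap.mem_ker, coboundary_eq, smul_eq_zero]
  exact or_iff_right (pow_ne_zero _ (neg_ne_zero.2 one_ne_zero))

theorem mem_coboundaries_succ_iff (A : PreLeibniz k a) {p : ℕ} {f : Cochain k a a (p + 1 + 1)} :
    f ∈ coboundaries (adjoint A) (p + 1) ↔ ∃ e, A.dπ p e = f := by
  simp only [coboundaries, LinearMap.mem_range, coboundary_eq]
  constructor
  · rintro ⟨e, rfl⟩
    exact ⟨(-1 : k) ^ p • e, map_smul _ _ _⟩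
  · rintro ⟨e, rfl⟩
    refine ⟨(-1 : k) ^ p • e, ?_⟩
    rw [map_smul, smul_smul, neg_one_pow_mul_self, one_smul]

theorem cohomologyClass_surjective (A : PreLeibniz k a) (p : ℕ) :
    Function.Surjective (cohomologyClass (adjoint A) p) :=
  Submodule.mkQ_surjective _

variable [CharZero k] (A : PreLeibniz k a)

theorem coboundaries_le_cocycles (p : ℕ) :
    coboundaries (adjoint A) p ≤ cocycles (adjoint A) p := by
  intro f hf
  cases p with
  | zero =>
    rw [coboundaries, Submodule.mem_bot] at hf
    rw [hf]
    exact Submodule.zero_mem _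
  | succ p =>
    obtain ⟨e, rfl⟩ := (mem_coboundaries_succ_iff A).1 hf
    exact (mem_cocycles_iff A).2 (dπ_dπ A p e)

variable {p q r : ℕ}

theorem plBracket_mem_cocycles (h : p + q = r) {f : Cochain k a a (p + 1)}
    {g : Cochain k a a (q + 1)} (hf : f ∈ cocycles (adjoint A) p)
    (hg : g ∈ cocycles (adjoint A) q) :
    plBracket k a p q r h f g ∈ cocycles (adjoint A) r := by
  rw [mem_cocycles_iff] at *
  rw [(isDGLie_plBracket A).d_br p q r h (by omega) (by omega), hf, hg]
  simp

/-- For a cocycle g the derivation rule gives [d e, g] = d [e, g]. -/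
theorem plBracket_mem_coboundaries_left (h : p + q = r) {f : Cochain k a a (p + 1)}
    {g : Cochain k a a (q + 1)} (hf : f ∈ coboundaries (adjoint A) p)
    (hg : g ∈ cocycles (adjoint A) q) :
    plBracket k a p q r h f g ∈ coboundaries (adjoint A) r := by
  cases p with
  | zero =>
    rw [coboundaries, Submodule.mem_bot] at hf
    rw [hf, map_zero, LinearMap.zero_apply]
    exact Submodule.zero_mem _
  | succ p =>
    obtain ⟨e, rfl⟩ := (mem_coboundaries_succ_iff A).1 hf
    -- The target degree is positive, so its coboundaries are an image and not the zero space of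
    -- degree 0.
    obtain ⟨r, rfl⟩ : ∃ s, r = s + 1 := ⟨p + q, by omega⟩
    rw [mem_coboundaries_succ_iff]
    refine ⟨plBracket k a p q r (by omega) e g, ?_⟩
    rw [(isDGLie_plBracket A).d_br p q r (by omega) h (by omega), (mem_cocycles_iff A).1 hg]
    simp

theorem plBracket_mem_coboundaries_right (h : p + q = r) {f : Cochain k a a (p + 1)}
    {g : Cochain k a a (q + 1)} (hf : f ∈ cocycles (adjoint A) p)
    (hg : g ∈ coboundaries (adjoint A) q) :
    plBracket k a p q r h f g ∈ coboundaries (adjoint A) r := by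
  rw [isGradedLie_plBracket.skew p q r h (by omega)]
  exact Submodule.neg_mem _ (Submodule.smul_mem _ _
    (plBracket_mem_coboundaries_left A _ hg hf))

/-- The bracket of cocycles. -/
def cocycleBracket (h : p + q = r) :
    cocycles (adjoint A) p →ₗ[k] cocycles (adjoint A) q →ₗ[k] cocycles (adjoint A) r :=
  LinearMap.mk₂ k
    (fun f g => ⟨plBracket k a p q r h f g, plBracket_mem_cocycles A h f.2 g.2⟩)
    (fun _ _ _ => Subtype.ext (by simp)) (fun _ _ _ => Subtype.ext (by simp))
    (fun _ _ _ => Subtype.ext (by simp)) (fun _ _ _ => Subtype.ext (by simp))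

/-- The bracket on the shifted cohomology. -/
def cohomologyBracket : GradedBilin k (fun p => Cohomology (adjoint A) p) := fun _ _ r h =>
  LinearMap.liftQ₂ _ _ ((cocycleBracket A h).compr₂ (cohomologyClass (adjoint A) r))
    (fun _ hf => LinearMap.ext fun g => (Submodule.Quotient.mk_eq_zero _).2
      (plBracket_mem_coboundaries_left A h hf g.2))
    (fun _ hg => LinearMap.ext fun f => (Submodule.Quotient.mk_eq_zero _).2
      (plBracket_mem_coboundaries_right A h f.2 hg))

theorem cohomologyBracket_class (h : p + q = r) (f : cocycles (adjoint A) p)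
    (g : cocycles (adjoint A) q) :
    cohomologyBracket A p q r h (cohomologyClass (adjoint A) p f)
        (cohomologyClass (adjoint A) q g) =
      cohomologyClass (adjoint A) r
        ⟨plBracket k a p q r h f g, plBracket_mem_cocycles A h f.2 g.2⟩ :=
  rfl

theorem isGradedLie_cohomologyBracket : IsGradedLie (cohomologyBracket A) where
  skew p q r h h' x y := by
    obtain ⟨f, rfl⟩ := cohomologyClass_surjective A p x
    obtain ⟨g, rfl⟩ := cohomologyClass_surjective A q y
    rw [cohomologyBracket_class, cohomologyBracket_class, ← map_smul, ← map_neg]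
    exact congrArg _ (Subtype.ext (isGradedLie_plBracket.skew p q r h h' f.1 g.1))
  jacobi p q s pq qs ps t hpq hqs hps h₁ h₂ h₃ x y z := by
    obtain ⟨f, rfl⟩ := cohomologyClass_surjective A p x
    obtain ⟨g, rfl⟩ := cohomologyClass_surjective A q y
    obtain ⟨e, rfl⟩ := cohomologyClass_surjective A s z
    simp only [cohomologyBracket_class]
    rw [← map_smul, ← map_add]
    exact congrArg _ (Subtype.ext (isGradedLie_plBracket.jacobi p q s pq qs ps t hpq hqs hps
      h₁ h₂ h₃ f.1 g.1 e.1))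

end CohomologyBracket

end PreLeib

end

/-! ### The theorem -/

theorem mainTheorem3 {k a : Type*} [Field k] [CharZero k] [AddCommGroup a] [Module k a]
    (A : PreLeib.PreLeibniz k a) :
    -- the differential graded Lie algebra of cochains
    PreLeib.IsDGLie (PreLeib.plBracket k a) A.dπ ∧
    -- its differential is, up to sign, the one that defines the adjoint cohomology
    (∀ (p : ℕ) (f : PreLeib.Cochain k a a (p + 1)),
      PreLeib.coboundary (PreLeib.adjoint A) p f = (-1 : k) ^ p • A.dπ p f) ∧
    (∀ p : ℕ, PreLeib.coboundaries (PreLeib.adjoint A) p ≤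
      PreLeib.cocycles (PreLeib.adjoint A) p) ∧
    -- the induced graded Lie algebra structure on the shifted cohomology
    ∃! br : PreLeib.GradedBilin k (fun p => PreLeib.Cohomology (PreLeib.adjoint A) p),
      PreLeib.IsGradedLie br ∧
      ∀ (p q r : ℕ) (h : p + q = r) (f : PreLeib.cocycles (PreLeib.adjoint A) p)
        (g : PreLeib.cocycles (PreLeib.adjoint A) q),
        ∃ hz : PreLeib.plBracket k a p q r h f g ∈ PreLeib.cocycles (PreLeib.adjoint A) r,
          br p q r h (PreLeib.cohomologyClass (PreLeib.adjoint A) p f)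
              (PreLeib.cohomologyClass (PreLeib.adjoint A) q g) =
            PreLeib.cohomologyClass (PreLeib.adjoint A) r
              ⟨PreLeib.plBracket k a p q r h f g, hz⟩ := by
  refine ⟨PreLeib.isDGLie_plBracket A, PreLeib.coboundary_eq A,
    PreLeib.coboundaries_le_cocycles A, PreLeib.cohomologyBracket A,
    ⟨PreLeib.isGradedLie_cohomologyBracket A, fun p q r h f g =>
      ⟨PreLeib.plBracket_mem_cocycles A h f.2 g.2, PreLeib.cohomologyBracket_class A h f g⟩⟩, ?_⟩
  -- Uniqueness uses only the formula on classes, since every cohomology element is the class of a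
  -- cocycle.
  rintro br ⟨-, hbr⟩
  funext p q r h
  refine LinearMap.ext fun x => LinearMap.ext fun y => ?_
  obtain ⟨f, rfl⟩ := PreLeib.cohomologyClass_surjective A p x
  obtain ⟨g, rfl⟩ := PreLeib.cohomologyClass_surjective A q y
  obtain ⟨_, e⟩ := hbr p q r h f g
  rw [e, PreLeib.cohomologyBracket_class]
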